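/- Let $q=4m+3$ be a prime, let $g$ be a common primitive root modulo $q$ and modulo $2q$, and for $i\in\{0,1\}$ put $D_i=\{g^{2s+i}: 0\le s<\tfrac{q-1}{2}\}$ and $E_i=2D_i$ in $\mathbb Z_{2q}$. Let $r$ be an odd prime with $r \bmod 2q\in D_0$, let $\ell_k=\mathrm{ord}_{2q}(r)$ and $\theta=\frac{q-1}{2\ell_k}$ (an integer). A quantum synchronizable code with parameters $(c_l,c_r)\text{-}[[N,k]]_r$ is an $r^k$-dimensional subspace of $(\mathbb C^r)^{\otimes N}$ for which one recovery operation, applied to the $N+c_l+c_r$ consecutive qudits that the block can occupy, restores every encoded state and identifies the block boundary whenever the assumed boundary is misplaced by at most $c_l$ to the left or at most $c_r$ to the right, whatever the state of the neighbouring qudits is. It corrects up to $a$ bit errors and $b$ phase errors if one such operation still works when at most $a$ bit errors and at most $b$ phase errors have occurred in the block. Then for every integer $z$ with $0\le z\le 2\theta-2=\frac{q-2\ell_k-1}{\ell_k}$ and all nonnegative integers $c_l,c_r$ with $c_l+c_r<2q$ there is a quantum synchronizable code with parameters $(c_l,c_r)\text{-}[[2q+c_l+c_r,\ 2z\ell_k+2]]_r$.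 These codes arise as follows. Primitive $2q$-th roots of unity exist in $\mathbb F_{r^{\ell_k}}$. Let $\eta$ be one, let $M_t$ be the minimal polynomial of $\eta^t$ over $\mathbb F_r$, and let $i,j\in\{0,1\}$. The polynomial $G=g_{D_i}g_{E_j}=\prod_{u\in D_i\cup E_j}(x-\eta^u)$ lies in $\mathbb F_r[x]$, and the cyclic code $C_{D_iE_j}=\langle G\rangle$ of length $2q$ over $\mathbb F_r$ contains its Euclidean dual. Let $T$ be a set of representatives of the $r$-cyclotomic cosets modulo $2q$ contained in $D_i\cup E_j$, and consider sets $S\subsetneq S'\subsetneq T$ with $S'\setminus S\subseteq D_0\cup D_1$. For every $z$ with $0\le z\le 2\theta-2$ there is such a pair with $|S|=z$. For every such pair, the augmented codes $C'=\langle G/\prod_{t\in S}M_t\rangle$ and $C''=\langle G/\prod_{t\in S'}M_t\rangle$ have dimensions $q+|S|\ell_k+1$ and $q+|S'|\ell_k+1$ and satisfy $C'^{\perp}\subseteq C'$ and $C_{D_iE_j}\subseteq C'\subsetneq C''$; the quotient $\prod_{t\in S'\setminus S}M_t$ of their generator polynomials has order $2q$ (the least $e\ge 1$ such that it divides $x^e-1$),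 the maximal possible value; and, for all nonnegative integers $c_l,c_r$ with $c_l+c_r<2q$, there is a quantum synchronizable code with parameters $(c_l,c_r)\text{-}[[2q+c_l+c_r,\ 2|S|\ell_k+2]]_r$ that corrects up to $\lfloor (d''-1)/2\rfloor$ bit errors and up to $\lfloor (d'-1)/2\rfloor$ phase errors, where $d',d''$ are the minimum distances of $C',C''$. -/

import Mathlib

open Polynomial

/-! ### Cyclotomic classes of order two modulo `2q` -/

/-- `g` is a common primitive root modulo `q` and modulo `2q` (`q` an odd prime). -/
def IsCommonPrimitiveRoot (q g : ℕ) : Prop :=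
  orderOf (g : ZMod q) = q - 1 ∧ orderOf (g : ZMod (2 * q)) = q - 1

/-- `D_i = {g ^ (2 s + i) : 0 ≤ s < (q - 1) / 2}` in `ℤ / 2q`. -/
def classD (q g : ℕ) (i : Fin 2) : Finset (ZMod (2 * q)) :=
  (Finset.range ((q - 1) / 2)).image fun s => (g : ZMod (2 * q)) ^ (2 * s + (i : ℕ))

/-- `E_i = {2 u : u ∈ D_i}` in `ℤ / 2q`. -/
def classE (q g : ℕ) (i : Fin 2) : Finset (ZMod (2 * q)) :=
  (classD q g i).image fun u => 2 * u

/-- The `r`-cyclotomic coset modulo `n` containing `t`. -/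
def cyclotomicCoset (r n : ℕ) (t : ZMod n) : Set (ZMod n) :=
  {a | ∃ s : ℕ, a = t * (r : ZMod n) ^ s}

/-- `T` consists of one representative of each `r`-cyclotomic coset modulo `n` contained in `A`
(used for sets `A` that are unions of cosets). -/
def IsCosetRepresentatives (r n : ℕ) (A T : Finset (ZMod n)) : Prop :=
  T ⊆ A ∧ ∀ a ∈ A, ∃! t, t ∈ T ∧ a ∈ cyclotomicCoset r n t

/-- `∏_{j ∈ A} (x - η ^ j)`; for `A = D_i`, `E_i` these are the polynomials `g_{D_i}`, `g_{E_i}`. -/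
noncomputable def rootsPoly {K : Type*} [Field K] {n : ℕ} (η : K) (A : Finset (ZMod n)) : K[X] :=
  ∏ j ∈ A, (X - C (η ^ j.val))

/-- `M_t`, the minimal polynomial of `η ^ t` over the prime field `𝔽_r`. -/
noncomputable def minimalPoly (r : ℕ) [Fact r.Prime] {K : Type*} [Field K] [Algebra (ZMod r) K]
    {n : ℕ} (η : K) (t : ZMod n) : (ZMod r)[X] :=
  minpoly (ZMod r) (η ^ t.val)

/-- `e` is the order of the polynomial `f`: the least positive integer with `f ∣ x ^ e - 1`. -/
def IsPolyOrder {F : Type*} [Field F] (f : F[X]) (e : ℕ) : Prop :=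
  IsLeast {d : ℕ | 0 < d ∧ f ∣ X ^ d - 1} e

/-! ### Linear codes -/

/-- The cyclic code `⟨g⟩` of length `n`: all words `(c_0, …, c_{n-1})` such that the class of
`c_0 + c_1 x + ⋯ + c_{n-1} x ^ (n - 1)` lies in the ideal of `F[x] / (x ^ n - 1)` generated by `g`;
equivalently, the polynomial lies in the ideal `(g, x ^ n - 1)` of `F[x]`. -/
noncomputable def cyclicCode {F : Type*} [Field F] (n : ℕ) (g : F[X]) : Submodule F (Fin n → F) :=
  Submodule.comap (∑ i : Fin n, (Polynomial.monomial (R := F) (i : ℕ)).comp (LinearMap.proj i))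
    ((Ideal.span {g, X ^ n - 1}).restrictScalars F)

/-- The Euclidean dual code. -/
def dualCode {F : Type*} [Field F] {n : ℕ} (C : Submodule F (Fin n → F)) :
    Submodule F (Fin n → F) where
  carrier := {x | ∀ c ∈ C, x ⬝ᵥ c = 0}
  add_mem' := by
    intro x y hx hy c hc
    rw [add_dotProduct, hx c hc, hy c hc, add_zero]
  zero_mem' := by
    intro c _
    exact zero_dotProduct c
  smul_mem' := by
    intro a x hx c hc
    rw [smul_dotProduct, hx c hc, smul_zero]

/-- The minimum distance (minimum weight of a nonzero codeword) of a nonzero linear code. -/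
noncomputable def minDistance {F : Type*} [Field F] [DecidableEq F] {n : ℕ}
    (C : Submodule F (Fin n → F)) : ℕ :=
  sInf {w : ℕ | ∃ c ∈ C, c ≠ 0 ∧ hammingNorm c = w}

/-! ### Quantum synchronizable codes -/

/-- The state space `(ℂ ^ r) ^ {⊗ N}` of `N` qudits of dimension `r`; the computational basis is
indexed by the strings in `(ℤ / r) ^ N`, and a vector is given by its amplitudes. -/
abbrev Qudits (r N : ℕ) : Type := EuclideanSpace ℂ (Fin N → ZMod r)

/-- The error `X ^ a Z ^ b : |v⟩ ↦ ω ^ (b · v) |v + a⟩`, `ω = exp (2 π i / r)`. The weight of `a` is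
the number of bit errors, the weight of `b` is the number of phase errors. -/
noncomputable def pauliError {r N : ℕ} [NeZero r] (a b : Fin N → ZMod r) (ψ : Qudits r N) :
    Qudits r N :=
  WithLp.toLp 2 fun v => ZMod.stdAddChar (b ⬝ᵥ (v - a)) * ψ (v - a)

/-- A stretch of `N + e` consecutive qudits of a stream in which a block of `N` qudits, in the
state `ψ`, starts at position `j`; the first `j` and the last `e - j` qudits belong to
the neighbouring blocks and are in the joint state `χ`. -/
noncomputable def inStream {r N e : ℕ} (j : Fin (e + 1)) (ψ : Qudits r N) (χ : Qudits r e) :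
    Qudits r (N + e) :=
  WithLp.toLp 2 fun w =>
    ψ (fun i : Fin N => w ⟨(j : ℕ) + i, by omega⟩) *
      χ (fun k : Fin e => w (if (k : ℕ) < j then ⟨k, by omega⟩ else ⟨k + N, by omega⟩))

/-- `Q` is a quantum synchronizable code with parameters `(c_l, c_r)-[[N, k]]_r` which corrects up
to `tX` bit errors and up to `tZ` phase errors.

`Q` is a subspace of dimension `r ^ k` of the space of `N` qudits. The receiver holds the `N + c_l +
c_r` qudits that the block can occupy when the assumed block boundary is off by at most `c_l` to
the left or at most `c_r` to the right; the assumed boundary is at position `c_r`. So the true block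
starts at position `j = c_r + s` if the receiver is misaligned by `s ≤ c_l` to the left, and at `j
= c_r - s` if misaligned by `s ≤ c_r` to the right: `j` runs through `0, …, c_l + c_r`.

A recovery operation is an isometry `V` into (block) ⊗ (offset register) ⊗ (environment). It
has to restore every state of `Q` and to write the true boundary `j` into the offset register,
whatever the misalignment, the errors within the stated bounds and the state `χ` of the
neighbouring qudits are; the final state `φ` of the environment does not depend on the
encoded state. By linearity, superpositions of these errors, and states entangled with other systems
(among them the neighbouring qudits), are then recovered as well. -/
def IsQuantumSynchronizableCode (r : ℕ) [NeZero r] (cl cr N k tX tZ : ℕ)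
    (Q : Submodule ℂ (Qudits r N)) : Prop :=
  Module.finrank ℂ Q = r ^ k ∧
  ∃ (M : ℕ) (V : Qudits r (N + (cl + cr)) →ₗᵢ[ℂ]
      EuclideanSpace ℂ ((Fin N → ZMod r) × Fin (cl + cr + 1) × Fin M)),
    ∀ (j : Fin (cl + cr + 1)) (a b : Fin N → ZMod r) (χ : Qudits r (cl + cr)),
      hammingNorm a ≤ tX → hammingNorm b ≤ tZ →
      ∃ φ : EuclideanSpace ℂ (Fin M), ∀ ψ ∈ Q,
        V (inStream j (pauliError a b ψ) χ) =
          WithLp.toLp 2 fun x => if x.2.1 = j then ψ x.1 * φ x.2.2 else 0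

/-!
The proof has a quantum half and a half about cyclic codes, joined by
`exists_isQuantumSynchronizableCode`.

*Quantum half.* Let `C₂ ⊆ C₁` be cyclic codes of length `n` with `C₂^⊥ ⊆ C₂`, and let `u ∈ C₁`
have shifts by `0, …, c_l + c_r` which are distinct modulo `C₂`. The code is spanned by the
uniform superpositions over the cosets of `C₂^⊥` in `u + C₂`, each word being extended
periodically to length `N = n + c_l + c_r`. The `n` letters in the middle of the received stream
lie in the block for every offset, and show a cyclic shift of a word of `u + C₂` up to bit errors.
As `C₁` contains it and corrects the bit errors, the class modulo `C₂` gives the offset, after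
which the whole string is known: distinct offsets, bit errors, neighbouring letters and words give
distinct strings (`streamWord_injective`). Phase errors on the block fold to phase errors of no
larger weight on words of length `n` (`hammingNorm_foldPhase_le`, `pauliError_relabel`), and these are told apart by their
classes modulo `C₂ = C₂^{⊥⊥}` (`orthonormal_cosetState`). So the basis states of the code,
displaced by all admissible offsets, errors and neighbours, form an orthonormal family. Sending it
to the family of the intended outcomes, with the errors and neighbours recorded in the
environment, extends to an isometry of the whole space (`exists_linearIsometry_of_orthonormal`),
the recovery operation.

*Cyclic codes.* A polynomial `∏_{t ∈ A} (x - η ^ t)` has coefficients in the prime field as soon as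
`r A ⊆ A` (`exists_map_eq_rootsPoly`), minimal polynomials belong to cyclotomic cosets
(`map_minimalPoly`), and the code contains its dual if `A ∩ -A = ∅` (`dualCode_cyclicCode_le`).
For `A ⊆ D_i ∪ E_j` the latter holds because `q ≡ 3 (mod 4)`, so that `-1` is not a square
(`neg_notMem_classD`). All cosets in `D_i ∪ E_j` have `ℓ` elements, which gives the dimensions.
In `exists_augmented_codes` the code `C₂` is `⟨G₂⟩` and the code `C₁` is `⟨G₁⟩`. An element
`t ∈ S' \ S` is a unit modulo `2q`, so that `η ^ t` is a primitive root; it is a zero of `⟨G₂⟩` but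
not of `G₁`. This forces the order of the quotient polynomial to be `2q`, and makes all shifts of
the coefficient word `u` of `G₁` by less than `2q` places distinct modulo `⟨G₂⟩`
(`eq_of_shift_sub_shift_mem`).
-/

/-! ### Isometries and orthonormal families -/

/-- Between finite-dimensional spaces, an orthonormal family can be carried to any orthonormal
family by an isometry of the whole space, provided the target is large enough. -/
theorem exists_linearIsometry_of_orthonormal {ι E E' : Type*} [Finite ι]
    [NormedAddCommGroup E] [InnerProductSpace ℂ E] [FiniteDimensional ℂ E]
    [NormedAddCommGroup E'] [InnerProductSpace ℂ E'] [FiniteDimensional ℂ E']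
    (hdim : Module.finrank ℂ E ≤ Module.finrank ℂ E')
    {v : ι → E} {w : ι → E'} (hv : Orthonormal ℂ v) (hw : Orthonormal ℂ w) :
    ∃ V : E →ₗᵢ[ℂ] E', ∀ i, V (v i) = w i := by
  obtain ⟨J⟩ : Nonempty (E →ₗᵢ[ℂ] E') := by
    let b := stdOrthonormalBasis ℂ E
    let b' := stdOrthonormalBasis ℂ E'
    have h1 : Orthonormal ℂ b.toBasis := by simp [b.orthonormal]
    refine ⟨LinearMap.isometryOfOrthonormal
      (b.toBasis.constr ℂ fun i => b' (Fin.castLE hdim i)) h1 ?_⟩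
    have : (b.toBasis.constr ℂ fun i => b' (Fin.castLE hdim i)) ∘ b.toBasis =
        b' ∘ Fin.castLE hdim := by
      ext1 i
      exact Module.Basis.constr_basis _ _ _ _
    rw [this]
    exact b'.orthonormal.comp _ (Fin.castLE_injective hdim)
  have hJv : Orthonormal ℂ (J ∘ v) := hv.comp_linearIsometry J
  let B := Module.Basis.span hJv.linearIndependent
  have hB : ∀ i, (B i : E') = J (v i) := fun i =>
    congrArg Subtype.val (Module.Basis.span_apply hJv.linearIndependent i)
  have hBo : Orthonormal ℂ B := by
    have : Orthonormal ℂ ((Submodule.span ℂ (Set.range (J ∘ v))).subtypeₗᵢ ∘ B) := by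
      convert hJv using 1
      ext1 i
      exact hB i
    exact (LinearIsometry.orthonormal_comp_iff _).1 this
  let L : Submodule.span ℂ (Set.range (J ∘ v)) →ₗᵢ[ℂ] E' :=
    LinearMap.isometryOfOrthonormal (B.constr ℂ w) hBo (by
      have : (B.constr ℂ w) ∘ B = w := by
        ext1 i
        exact Module.Basis.constr_basis _ _ _ _
      rwa [this])
  refine ⟨L.extend.comp J, fun i => ?_⟩
  change L.extend (J (v i)) = w i
  rw [← hB i, LinearIsometry.extend_apply]
  exact Module.Basis.constr_basis _ _ _ _

open Classical in
/-- The state `∑ y, φ y |s y⟩` obtained from `∑ y, φ y |y⟩` by relabelling the computational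
basis along `s`. -/
noncomputable def relabel {X Y : Type*} [Fintype Y] (s : Y → X) (φ : EuclideanSpace ℂ Y) :
    EuclideanSpace ℂ X :=
  ∑ y, φ y • EuclideanSpace.single (s y) (1 : ℂ)

theorem relabel_apply {X Y : Type*} [DecidableEq X] [Fintype Y] (s : Y → X)
    (φ : EuclideanSpace ℂ Y) (x : X) :
    relabel s φ x = ∑ y, if x = s y then φ y else 0 := by
  classical
  simp [relabel, Pi.single_apply]

open Classical in
theorem inner_relabel {X Y : Type*} [Fintype X] [Fintype Y] (s s' : Y → X)
    (φ φ' : EuclideanSpace ℂ Y) :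
    inner ℂ (relabel s φ) (relabel s' φ') =
      ∑ y, ∑ y', if s y = s' y' then (starRingEnd ℂ) (φ y) * φ' y' else 0 := by
  rw [relabel, sum_inner]
  refine Finset.sum_congr rfl fun y _ => ?_
  rw [inner_smul_left, EuclideanSpace.inner_single_left, relabel_apply, map_one, one_mul,
    Finset.mul_sum]
  simp

/-- States relabelled along maps with disjoint ranges are orthogonal, and an injective relabelling
preserves inner products. -/
theorem orthonormal_relabel {X Y I₁ I₂ : Type*} [Fintype X] [Fintype Y]
    (s : I₁ → Y → X) (hs : ∀ p y p' y', s p y = s p' y' → p = p' ∧ y = y')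
    {φ : I₂ → EuclideanSpace ℂ Y} (hφ : Orthonormal ℂ φ) :
    Orthonormal ℂ fun k : I₁ × I₂ => relabel (s k.1) (φ k.2) := by
  classical
  rw [orthonormal_iff_ite] at hφ ⊢
  rintro ⟨p, k⟩ ⟨p', k'⟩
  simp only [inner_relabel]
  by_cases hp : p = p'
  · subst hp
    have h := hφ k k'
    rw [PiLp.inner_apply] at h
    simp only [Prod.mk.injEq, true_and]
    rw [← h]
    refine Finset.sum_congr rfl fun y _ => ?_
    rw [Finset.sum_eq_single y]
    · simp [mul_comm]
    · intro y' _ hy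
      rw [if_neg fun hh => hy (hs _ _ _ _ hh).2.symm]
    · simp
  · rw [if_neg (by simp [hp])]
    refine Finset.sum_eq_zero fun y _ => Finset.sum_eq_zero fun y' _ => ?_
    rw [if_neg fun hh => hp (hs _ _ _ _ hh).1]

/-! ### Dual codes -/

theorem dualCode_eq_comap {F : Type*} [Field F] {n : ℕ} (C : Submodule F (Fin n → F)) :
    dualCode C = (Submodule.dualAnnihilator C).comap (dotProductEquiv F (Fin n)).toLinearMap := by
  ext x
  simp only [Submodule.mem_comap, Submodule.mem_dualAnnihilator, LinearEquiv.coe_coe,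
    dotProductEquiv_apply_apply]
  rfl

theorem finrank_add_finrank_dualCode {F : Type*} [Field F] {n : ℕ}
    (C : Submodule F (Fin n → F)) :
    Module.finrank F C + Module.finrank F (dualCode C) = n := by
  have h : Module.finrank F (dualCode C) = Module.finrank F (Submodule.dualAnnihilator C) := by
    rw [dualCode_eq_comap]
    exact LinearEquiv.finrank_eq (LinearEquiv.ofSubmodule' _ _)
  rw [h, Subspace.finrank_add_finrank_dualAnnihilator_eq, Module.finrank_fin_fun]

/-- The nontrivial half of `C^{⊥⊥} = C`. -/
theorem exists_mem_dualCode_dotProduct_ne_zero {F : Type*} [Field F] {n : ℕ}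
    {C : Submodule F (Fin n → F)} {b : Fin n → F} (hb : b ∉ C) :
    ∃ d ∈ dualCode C, b ⬝ᵥ d ≠ 0 := by
  obtain ⟨f, hf, hC⟩ := Submodule.exists_le_ker_of_notMem hb
  obtain ⟨d, rfl⟩ := (dotProductEquiv F (Fin n)).surjective f
  refine ⟨d, fun c hc => by simpa using hC hc, ?_⟩
  rwa [dotProduct_comm, ← dotProductEquiv_apply_apply]

theorem eq_zero_of_hammingNorm_le {F : Type*} [Field F] [DecidableEq F] {n : ℕ}
    {C : Submodule F (Fin n → F)} {c : Fin n → F} (hc : c ∈ C)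
    (h : hammingNorm c ≤ 2 * ((minDistance C - 1) / 2)) : c = 0 := by
  by_contra h0
  have hmem : hammingNorm c ∈ {w : ℕ | ∃ c ∈ C, c ≠ 0 ∧ hammingNorm c = w} := ⟨c, hc, h0, rfl⟩
  have hle : minDistance C ≤ hammingNorm c := Nat.sInf_le hmem
  have hpos : 0 < hammingNorm c := hammingNorm_pos_iff.2 h0
  omega

theorem eq_of_sub_mem_of_hammingNorm_le {F : Type*} [Field F] [DecidableEq F] {n : ℕ}
    {C : Submodule F (Fin n → F)} {b b' : Fin n → F} (h : b - b' ∈ C)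
    (hb : hammingNorm b ≤ (minDistance C - 1) / 2)
    (hb' : hammingNorm b' ≤ (minDistance C - 1) / 2) : b = b' := by
  refine sub_eq_zero.1 (eq_zero_of_hammingNorm_le h ?_)
  have : hammingNorm (b - b') ≤ hammingNorm b + hammingNorm b' := by
    calc hammingNorm (b - b') = hammingDist b b' := by
          rw [hammingDist_comm, hammingDist_eq_hammingNorm, neg_add_eq_sub]
      _ ≤ hammingDist b 0 + hammingDist 0 b' := hammingDist_triangle _ _ _
      _ = _ := by rw [hammingDist_zero_right, hammingDist_zero_left]
  omega

/-! ### Coset states -/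

section CosetState

variable {r : ℕ} [Fact r.Prime] {n : ℕ}

/-- `C^⊥ ∩ C` as a subspace of `C`. -/
def dualIn (C : Submodule (ZMod r) (Fin n → ZMod r)) : Submodule (ZMod r) C :=
  (dualCode C).comap C.subtype

open Classical in
/-- The uniform superposition over the coset `v` of `C^⊥` in `C`, translated by `u`, after the phase
error `b`. The basis state `|u + c⟩` is labelled by `c ∈ C`. -/
noncomputable def cosetState (C : Submodule (ZMod r) (Fin n → ZMod r)) (u : Fin n → ZMod r)
    (v : C ⧸ dualIn C) (b : Fin n → ZMod r) : EuclideanSpace ℂ C :=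
  WithLp.toLp 2 fun c => if Submodule.Quotient.mk c = v then
    ((√(Nat.card {c : C // (Submodule.Quotient.mk c : C ⧸ dualIn C) = v}) : ℝ) : ℂ)⁻¹ *
      ZMod.stdAddChar (b ⬝ᵥ (u + c)) else 0

/-- The states `cosetState C u v b` are orthonormal as long as distinct phase errors have distinct
syndromes, i.e. are distinct modulo `C = C^{⊥⊥}`. -/
theorem orthonormal_cosetState (C : Submodule (ZMod r) (Fin n → ZMod r)) [Fintype C]
    (hC : dualCode C ≤ C) (u : Fin n → ZMod r) (B : Set (Fin n → ZMod r))
    (hB : ∀ b ∈ B, ∀ b' ∈ B, b - b' ∈ C → b = b') :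
    Orthonormal ℂ fun k : (C ⧸ dualIn C) × B => cosetState C u k.1 k.2 := by
  classical
  rw [orthonormal_iff_ite]
  rintro ⟨v, b, hb⟩ ⟨v', b', hb'⟩
  rw [EuclideanSpace.inner_eq_star_dotProduct]
  by_cases hv : v = v'
  swap
  · rw [if_neg (by simp [hv])]
    refine Finset.sum_eq_zero fun c _ => ?_
    simp only [cosetState, Pi.star_apply]
    by_cases hc : Submodule.Quotient.mk c = v
    · rw [if_neg (hc ▸ hv), zero_mul]
    · simp [hc]
  subst hv
  set κ : ℝ := √(Nat.card {c : C // (Submodule.Quotient.mk c : C ⧸ dualIn C) = v}) with hκ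
  have key : ∀ c : C, (cosetState C u v b').ofLp c * star ((cosetState C u v b).ofLp c) =
      if (Submodule.Quotient.mk c : C ⧸ dualIn C) = v then
        (κ : ℂ)⁻¹ * (κ : ℂ)⁻¹ * ZMod.stdAddChar ((b' - b) ⬝ᵥ (u + c)) else 0 := by
    intro c
    simp only [cosetState]
    split_ifs
    · rw [star_mul', star_inv₀, sub_dotProduct, sub_eq_add_neg, AddChar.map_add_eq_mul,
        AddChar.map_neg_eq_conj]
      simp only [Complex.star_def, Complex.conj_ofReal]
      ring
    · simp
  have key' : (cosetState C u v b').ofLp ⬝ᵥ star (cosetState C u v b).ofLp = ∑ c : C,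
      if (Submodule.Quotient.mk c : C ⧸ dualIn C) = v then
        (κ : ℂ)⁻¹ * (κ : ℂ)⁻¹ * ZMod.stdAddChar ((b' - b) ⬝ᵥ (u + c)) else 0 :=
    Finset.sum_congr rfl fun c _ => key c
  simp only [key']
  by_cases hbb : b = b'
  · subst hbb
    simp only [sub_self, zero_dotProduct, AddChar.map_zero_eq_one, mul_one, if_true]
    rw [← Finset.sum_filter, Finset.sum_const, nsmul_eq_mul]
    have hcard : ((Finset.univ.filter
        fun c : C => (Submodule.Quotient.mk c : C ⧸ dualIn C) = v).card : ℝ) = κ * κ := by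
      rw [hκ, Real.mul_self_sqrt (Nat.cast_nonneg _), Nat.card_eq_fintype_card,
        Fintype.card_subtype]
    have hpos : κ ≠ 0 := by
      obtain ⟨c, hc⟩ := Submodule.Quotient.mk_surjective _ v
      have : Nonempty {c : C // (Submodule.Quotient.mk c : C ⧸ dualIn C) = v} := ⟨⟨c, hc⟩⟩
      exact Real.sqrt_ne_zero'.2 (Nat.cast_pos.2 Nat.card_pos)
    have hcard' : ((Finset.univ.filter
        fun c : C => (Submodule.Quotient.mk c : C ⧸ dualIn C) = v).card : ℂ) = κ * κ := by
      exact_mod_cast congrArg (fun x : ℝ => (x : ℂ)) hcard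
    rw [hcard']
    have : (κ : ℂ) ≠ 0 := by exact_mod_cast hpos
    field_simp
  · rw [if_neg (by simp [hbb])]
    obtain ⟨d, hd, hne⟩ := exists_mem_dualCode_dotProduct_ne_zero
      (C := C) (b := b' - b) fun h => hbb (hB _ hb' _ hb h).symm
    set z : ℂ := ZMod.stdAddChar ((b' - b) ⬝ᵥ d) with hz
    have hz1 : z ≠ 1 := by
      intro h
      rw [hz, ← AddChar.map_zero_eq_one (ZMod.stdAddChar (N := r))] at h
      exact hne (ZMod.injective_stdAddChar h)
    -- translating the summation variable by `d ∈ C^⊥` multiplies the sum by `z ≠ 1`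
    set S := ∑ c : C, if (Submodule.Quotient.mk c : C ⧸ dualIn C) = v then
        (κ : ℂ)⁻¹ * (κ : ℂ)⁻¹ * ZMod.stdAddChar ((b' - b) ⬝ᵥ (u + c)) else 0 with hS
    have hSz : S = z * S := by
      let d' : C := ⟨d, hC hd⟩
      have hd' : (Submodule.Quotient.mk d' : C ⧸ dualIn C) = 0 :=
        (Submodule.Quotient.mk_eq_zero _).2 hd
      conv_lhs => rw [hS]
      rw [hS, Finset.mul_sum, ← Equiv.sum_comp (Equiv.addRight d')]
      refine Finset.sum_congr rfl fun c _ => ?_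
      simp only [Equiv.coe_addRight, Submodule.Quotient.mk_add, hd', add_zero]
      split_ifs
      · have : u + ((c + d' : C) : Fin n → ZMod r) = (u + c) + d := by
          simp [d', add_assoc]
        rw [this, dotProduct_add _ _ d, AddChar.map_add_eq_mul, hz]
        ring
      · simp
    have : (1 - z) * S = 0 := by linear_combination hSz
    exact (mul_eq_zero.1 this).resolve_left (sub_ne_zero.2 hz1.symm)

end CosetState

/-! ### Cyclic extension and position in the stream -/

section Stream

variable {r : ℕ}

/-- The periodic extension of a word of length `n` to length `N`. -/
def cyclicExtension {n : ℕ} [NeZero n] (N : ℕ) (y : Fin n → ZMod r) : Fin N → ZMod r :=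
  fun i => y (Fin.ofNat n i)

/-- The phase pattern on words of length `n` which a phase pattern `b` on their periodic extensions
amounts to. -/
def foldPhase {n : ℕ} [NeZero n] {N : ℕ} (b : Fin N → ZMod r) : Fin n → ZMod r :=
  fun k => ∑ i ∈ Finset.univ.filter fun i : Fin N => Fin.ofNat n (i : ℕ) = k, b i

theorem dotProduct_cyclicExtension {n : ℕ} [NeZero n] {N : ℕ} (b : Fin N → ZMod r)
    (y : Fin n → ZMod r) : b ⬝ᵥ cyclicExtension N y = foldPhase b ⬝ᵥ y := by
  simp only [dotProduct, cyclicExtension, foldPhase, Finset.sum_mul]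
  rw [← Finset.sum_fiberwise Finset.univ fun i : Fin N => Fin.ofNat n (i : ℕ)]
  refine Finset.sum_congr rfl fun k _ => Finset.sum_congr rfl fun i hi => ?_
  rw [(Finset.mem_filter.1 hi).2]

theorem hammingNorm_foldPhase_le {n : ℕ} [NeZero n] {N : ℕ} (b : Fin N → ZMod r) :
    hammingNorm (foldPhase b : Fin n → ZMod r) ≤ hammingNorm b := by
  unfold hammingNorm
  refine le_trans (Finset.card_le_card ?_)
    (Finset.card_image_le (s := {i : Fin N | b i ≠ 0}) (f := fun i : Fin N => Fin.ofNat n (i : ℕ)))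
  intro k hk
  obtain ⟨i, hi, hne⟩ := Finset.exists_ne_zero_of_sum_ne_zero (Finset.mem_filter.1 hk).2
  exact Finset.mem_image.2
    ⟨i, Finset.mem_filter.2 ⟨Finset.mem_univ _, hne⟩, (Finset.mem_filter.1 hi).2⟩

theorem hammingNorm_comp_le {ι κ F : Type*} [Fintype ι] [Fintype κ] [Zero F] [DecidableEq F]
    (a : κ → F) {f : ι → κ} (hf : Function.Injective f) :
    hammingNorm (fun i => a (f i)) ≤ hammingNorm a := by
  unfold hammingNorm
  exact Finset.card_le_card_of_injOn f (fun i hi => by simpa using hi) hf.injOn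

/-- The positions of the block and of the neighbouring qudits in the stream. -/
def streamPos {N e : ℕ} (j : Fin (e + 1)) : Fin N ⊕ Fin e → Fin (N + e) :=
  Sum.elim (fun i => ⟨(j : ℕ) + i, by omega⟩)
    fun k => if (k : ℕ) < j then ⟨k, by omega⟩ else ⟨k + N, by omega⟩

theorem bijective_streamPos {N e : ℕ} (j : Fin (e + 1)) :
    Function.Bijective (streamPos (N := N) j) := by
  rw [Fintype.bijective_iff_injective_and_card]
  refine ⟨?_, by simp⟩
  rintro (i | k) (i' | k') h
  all_goals
    simp only [streamPos, Sum.elim_inl, Sum.elim_inr] at h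
    try split_ifs at h
    all_goals
      simp only [Fin.mk.injEq] at h
      first
        | (congr 1; ext; omega)
        | (exfalso; omega)

/-- The string consisting of the block `x`, starting at position `j`, and of the letters `w` in the
other positions. -/
noncomputable def streamWord {N e : ℕ} (j : Fin (e + 1)) (x : Fin N → ZMod r)
    (w : Fin e → ZMod r) : Fin (N + e) → ZMod r :=
  Sum.elim x w ∘ (Equiv.ofBijective _ (bijective_streamPos j)).symm

theorem streamWord_comp_streamPos {N e : ℕ} (j : Fin (e + 1)) (x : Fin N → ZMod r)
    (w : Fin e → ZMod r) : streamWord j x w ∘ streamPos j = Sum.elim x w := by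
  ext t
  exact congrArg _ (Equiv.ofBijective_symm_apply_apply _ (bijective_streamPos j) t)

theorem eq_streamWord_iff {N e : ℕ} (j : Fin (e + 1)) (x : Fin N → ZMod r)
    (w : Fin e → ZMod r) (p : Fin (N + e) → ZMod r) :
    p = streamWord j x w ↔
      (fun i : Fin N => p (streamPos j (Sum.inl i))) = x ∧
        (fun k : Fin e => p (streamPos j (Sum.inr k))) = w := by
  rw [← (bijective_streamPos j).surjective.injective_comp_right.eq_iff, streamWord_comp_streamPos]
  constructor
  · intro h
    exact ⟨funext fun i => congrFun h (Sum.inl i), funext fun k => congrFun h (Sum.inr k)⟩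
  · rintro ⟨rfl, rfl⟩
    ext (i | k) <;> rfl

theorem streamWord_apply {N e : ℕ} (j : Fin (e + 1)) (x : Fin N → ZMod r)
    (w : Fin e → ZMod r) (i : Fin N) (h : (j : ℕ) + i < N + e) :
    streamWord j x w ⟨(j : ℕ) + i, h⟩ = x i :=
  congrFun (streamWord_comp_streamPos j x w) (Sum.inl i)

theorem inStream_single [NeZero r] {N e : ℕ} (j : Fin (e + 1)) (ψ : Qudits r N) (χ : Qudits r e) :
    inStream j ψ χ = ∑ w, χ w • inStream j ψ (EuclideanSpace.single w 1) := by
  ext p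
  simp [inStream, mul_comm]

theorem inStream_relabel {N e : ℕ} (j : Fin (e + 1)) {Y : Type*} [Fintype Y]
    (s : Y → Fin N → ZMod r) (φ : EuclideanSpace ℂ Y) (w : Fin e → ZMod r) :
    inStream j (relabel s φ) (EuclideanSpace.single w 1) =
      relabel (fun y => streamWord j (s y) w) φ := by
  ext p
  rw [relabel_apply]
  simp only [eq_streamWord_iff]
  change relabel s φ (fun i : Fin N => p (streamPos j (Sum.inl i))) *
    EuclideanSpace.single w (1 : ℂ) (fun k => p (streamPos j (Sum.inr k))) = _
  rw [relabel_apply, Finset.sum_mul]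
  refine Finset.sum_congr rfl fun y _ => ?_
  by_cases h : (fun k => p (streamPos j (Sum.inr k))) = w
  · simp [h]
  · simp [h]

end Stream

/-- The errors act on a periodically extended coset state by a phase pattern on the words before
extension and by a translation. -/
theorem pauliError_relabel {r : ℕ} [Fact r.Prime] {n N : ℕ} [NeZero n]
    {C : Submodule (ZMod r) (Fin n → ZMod r)} [Fintype C] (u : Fin n → ZMod r)
    (v : C ⧸ dualIn C) (a b : Fin N → ZMod r) :
    pauliError a b (relabel (fun c : C => cyclicExtension N (u + (c : Fin n → ZMod r)))
        (cosetState C u v 0)) =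
      relabel (fun c : C => cyclicExtension N (u + (c : Fin n → ZMod r)) + a)
        (cosetState C u v (foldPhase b)) := by
  ext x
  rw [relabel_apply]
  simp only [pauliError, relabel_apply, Finset.mul_sum]
  refine Finset.sum_congr rfl fun c _ => ?_
  by_cases h : x - a = cyclicExtension N (u + (c : Fin n → ZMod r))
  · rw [if_pos h, if_pos (sub_eq_iff_eq_add.1 h), h, dotProduct_cyclicExtension]
    simp only [cosetState]
    split_ifs
    · simp [mul_comm]
    · simp
  · rw [if_neg h, if_neg fun h' => h (sub_eq_iff_eq_add.2 h'), mul_zero]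

/-- Where the synchronization happens: the `n` letters from position `e` on belong to the block for
every offset `j`. They show a cyclic shift of a word of `C₁` up to bit errors; the code `C₁`
corrects them, and the class of the corrected word modulo `C₂` reveals the shift. -/
theorem streamWord_injective {r : ℕ} [Fact r.Prime] {n N e tX : ℕ} [NeZero n] (hN : N = n + e)
    {C₁ C₂ : Submodule (ZMod r) (Fin n → ZMod r)} (h21 : C₂ ≤ C₁)
    (hc₁ : ∀ y ∈ C₁, ∀ k : Fin n, (fun i => y (i + k)) ∈ C₁)
    (hc₂ : ∀ y ∈ C₂, ∀ k : Fin n, (fun i => y (i + k)) ∈ C₂)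
    (htX : tX ≤ (minDistance C₁ - 1) / 2) {u : Fin n → ZMod r} (hu : u ∈ C₁)
    (hshift : ∀ k k' : ℕ, k ≤ e → k' ≤ e →
      (fun i => u (i + Fin.ofNat n k) - u (i + Fin.ofNat n k')) ∈ C₂ → k = k')
    {j j' : Fin (e + 1)} {a a' : Fin N → ZMod r} (ha : hammingNorm a ≤ tX)
    (ha' : hammingNorm a' ≤ tX) {w w' : Fin e → ZMod r} {c c' : Fin n → ZMod r}
    (hc : c ∈ C₂) (hc' : c' ∈ C₂)
    (h : streamWord j (cyclicExtension N (u + c) + a) w =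
      streamWord j' (cyclicExtension N (u + c') + a') w') :
    j = j' ∧ a = a' ∧ w = w' ∧ c = c' := by
  subst hN
  have hpos : ∀ (k : ℕ) (i : Fin n), Fin.ofNat n (k + i) = i + Fin.ofNat n k := by
    intro k i
    ext
    simp [Fin.val_add, add_comm]
  have hlt : ∀ (k : Fin (e + 1)) (i : Fin n), e - k + i < n + e := fun k i => by omega
  have hread : ∀ (l : Fin (e + 1)) (b z : Fin (n + e) → ZMod r) (w : Fin e → ZMod r) (i : Fin n),
      streamWord l (z + b) w ⟨e + i, by omega⟩ =
        z ⟨e - l + i, hlt l i⟩ + b ⟨e - l + i, hlt l i⟩ := by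
    intro l b z w i
    have := streamWord_apply l (z + b) w ⟨e - l + i, hlt l i⟩ (by simp only []; omega)
    rw [← Pi.add_apply, ← this]
    congr 2
    simp only []
    omega
  have hwin : ∀ i : Fin n,
      (u + c) (i + Fin.ofNat n (e - j)) + a ⟨e - j + i, hlt j i⟩ =
        (u + c') (i + Fin.ofNat n (e - j')) + a' ⟨e - j' + i, hlt j' i⟩ := by
    intro i
    have := congrFun h ⟨e + i, by omega⟩
    rw [hread, hread] at this
    simpa only [cyclicExtension, hpos] using this
  have hA : (fun i : Fin n => a ⟨e - j + i, hlt j i⟩) =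
      fun i : Fin n => a' ⟨e - j' + i, hlt j' i⟩ := by
    refine eq_of_sub_mem_of_hammingNorm_le (C := C₁) ?_
      (((hammingNorm_comp_le a ?_).trans ha).trans htX)
      (((hammingNorm_comp_le a' ?_).trans ha').trans htX)
    · have := C₁.sub_mem (hc₁ _ (C₁.add_mem hu (h21 hc')) (Fin.ofNat n (e - j')))
        (hc₁ _ (C₁.add_mem hu (h21 hc)) (Fin.ofNat n (e - j)))
      convert this using 1
      ext i
      simp only [Pi.sub_apply]
      linear_combination hwin i
    all_goals
      intro i i' hii
      simp only [Fin.mk.injEq] at hii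
      ext
      omega
  have hjj : e - (j : ℕ) = e - j' := by
    refine hshift _ _ (by omega) (by omega) ?_
    have := C₂.sub_mem (hc₂ _ hc' (Fin.ofNat n (e - j'))) (hc₂ _ hc (Fin.ofNat n (e - j)))
    convert this using 1
    ext i
    have h1 := hwin i
    have h2 := congrFun hA i
    simp only [Pi.add_apply] at h1
    simp only [Pi.sub_apply]
    linear_combination h1 - h2
  obtain rfl : j = j' := by ext; omega
  have hcc : c = c' := by
    ext i
    have h1 := hwin (i - Fin.ofNat n (e - j))
    have h2 := congrFun hA (i - Fin.ofNat n (e - j))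
    simp only [sub_add_cancel, Pi.add_apply] at h1
    linear_combination h1 - h2
  subst hcc
  obtain ⟨hx, hw⟩ := (eq_streamWord_iff j _ w' _).1 h
  obtain ⟨hx', hw'⟩ := (eq_streamWord_iff j _ w _).1 rfl
  exact ⟨rfl, add_left_cancel (hx'.symm.trans hx), hw'.symm.trans hw, rfl⟩

/-! ### Synchronizable codes from pairs of cyclic codes -/

theorem cyclicExtension_injective {r n N : ℕ} [NeZero n] (h : n ≤ N) :
    Function.Injective (cyclicExtension N : (Fin n → ZMod r) → Fin N → ZMod r) := by
  intro y y' hy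
  ext i
  have := congrFun hy ⟨i, i.2.trans_le h⟩
  simpa [cyclicExtension] using this

theorem finrank_quotient_dualIn {r : ℕ} [Fact r.Prime] {n : ℕ}
    {C : Submodule (ZMod r) (Fin n → ZMod r)} (hC : dualCode C ≤ C) :
    Module.finrank (ZMod r) (C ⧸ dualIn C) = 2 * Module.finrank (ZMod r) C - n := by
  have h1 := finrank_add_finrank_dualCode C
  have h2 : Module.finrank (ZMod r) (dualIn C) = Module.finrank (ZMod r) (dualCode C) :=
    LinearEquiv.finrank_eq (Submodule.comapSubtypeEquivOfLe hC)
  rw [Submodule.finrank_quotient, h2]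
  omega

/-- A dual-containing cyclic code `C₂` inside a cyclic code `C₁`, together with a word `u` of `C₁`
whose shifts by `0, …, c_l + c_r` are distinct modulo `C₂`, gives a quantum synchronizable code. It
is spanned by the periodic extensions of the uniform superpositions over the cosets of `C₂^⊥` in
`u + C₂`. The bit errors, the offset and the phase errors move this span to mutually orthogonal
subspaces, so that one isometry can undo all of them. -/
theorem exists_isQuantumSynchronizableCode {r : ℕ} [Fact r.Prime] {n N cl cr tX tZ : ℕ} [NeZero n]
    (hN : N = n + (cl + cr)) {C₁ C₂ : Submodule (ZMod r) (Fin n → ZMod r)} (h21 : C₂ ≤ C₁)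
    (hdual : dualCode C₂ ≤ C₂)
    (hc₁ : ∀ y ∈ C₁, ∀ k : Fin n, (fun i => y (i + k)) ∈ C₁)
    (hc₂ : ∀ y ∈ C₂, ∀ k : Fin n, (fun i => y (i + k)) ∈ C₂)
    (htX : tX ≤ (minDistance C₁ - 1) / 2) (htZ : tZ ≤ (minDistance C₂ - 1) / 2)
    {u : Fin n → ZMod r} (hu : u ∈ C₁)
    (hshift : ∀ k k' : ℕ, k ≤ cl + cr → k' ≤ cl + cr →
      (fun i => u (i + Fin.ofNat n k) - u (i + Fin.ofNat n k')) ∈ C₂ → k = k') :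
    ∃ Q : Submodule ℂ (Qudits r N), IsQuantumSynchronizableCode r cl cr N
      (2 * Module.finrank (ZMod r) C₂ - n) tX tZ Q := by
  let : Fintype C₂ := Fintype.ofFinite C₂
  let : Fintype (C₂ ⧸ dualIn C₂) := Fintype.ofFinite _
  set e := cl + cr
  let s : C₂ → Fin N → ZMod r := fun c => cyclicExtension N (u + (c : Fin n → ZMod r))
  have hs : Function.Injective s := fun c c' h =>
    Subtype.ext (add_left_cancel (cyclicExtension_injective (by omega) h))
  let B : Set (Fin n → ZMod r) := {b | hammingNorm b ≤ tZ}
  have hφ := orthonormal_cosetState C₂ hdual u B fun b hb b' hb' h =>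
    eq_of_sub_mem_of_hammingNorm_le h (le_trans hb htZ) (le_trans hb' htZ)
  have hφ0 : Orthonormal ℂ fun v => cosetState C₂ u v 0 :=
    hφ.comp (fun v => (v, (⟨0, by simp [B]⟩ : B))) fun v v' h => (Prod.mk.inj h).1
  let ψ : C₂ ⧸ dualIn C₂ → Qudits r N := fun v => relabel s (cosetState C₂ u v 0)
  have hψ : Orthonormal ℂ ψ :=
    (orthonormal_relabel (I₁ := Unit) (fun _ => s) (fun _ _ _ _ h => ⟨rfl, hs h⟩) hφ0).comp
      (fun v => ((), v)) fun v v' h => (Prod.mk.inj h).2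
  refine ⟨Submodule.span ℂ (Set.range ψ), ?_, ?_⟩
  · rw [finrank_span_eq_card hψ.linearIndependent, Module.card_eq_pow_finrank (K := ZMod r),
      ZMod.card, finrank_quotient_dualIn hdual]
  -- the environment records the bit errors, the folded phase errors and the neighbouring letters
  let Env := (Fin N → ZMod r) × (Fin n → ZMod r) × (Fin e → ZMod r)
  obtain ⟨M, ⟨enc⟩, hM⟩ : ∃ M, Nonempty (Env ≃ Fin M) ∧ M = Fintype.card Env :=
    ⟨_, ⟨Fintype.equivFin Env⟩, rfl⟩
  let A : Set (Fin N → ZMod r) := {a | hammingNorm a ≤ tX}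
  have hinj : ∀ (p : Fin (e + 1) × A × (Fin e → ZMod r)) (c : C₂)
      (p' : Fin (e + 1) × A × (Fin e → ZMod r)) (c' : C₂),
      streamWord p.1 (s c + p.2.1.1) p.2.2 = streamWord p'.1 (s c' + p'.2.1.1) p'.2.2 →
        p = p' ∧ c = c' := by
    rintro ⟨j, ⟨a, ha⟩, w⟩ c ⟨j', ⟨a', ha'⟩, w'⟩ c' h
    obtain ⟨rfl, rfl, rfl, hcc⟩ :=
      streamWord_injective hN h21 hc₁ hc₂ htX hu hshift ha ha' c.2 c'.2 h
    exact ⟨rfl, Subtype.ext hcc⟩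
  have hsrc := orthonormal_relabel
    (fun (p : Fin (e + 1) × A × (Fin e → ZMod r)) (c : C₂) =>
      streamWord p.1 (s c + p.2.1.1) p.2.2) hinj hφ
  let tgt' : (Fin (e + 1) × Fin (M)) × (C₂ ⧸ dualIn C₂) →
      EuclideanSpace ℂ ((Fin N → ZMod r) × Fin (e + 1) × Fin (M)) :=
    fun k => relabel (fun c => (s c, k.1)) (cosetState C₂ u k.2 0)
  have htgt' : Orthonormal ℂ tgt' := by
    have h := orthonormal_relabel (fun (p : Fin (e + 1) × Fin M) (c : C₂) => (s c, p))
      (fun p c p' c' h => ⟨(Prod.mk.inj h).2, hs (Prod.mk.inj h).1⟩) hφ0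
    exact h
  have htgt := htgt'.comp
    (fun k : (Fin (e + 1) × A × (Fin e → ZMod r)) × ((C₂ ⧸ dualIn C₂) × B) =>
      ((k.1.1, enc (k.1.2.1.1, k.2.2.1, k.1.2.2)), k.2.1)) (by
        rintro ⟨⟨j, a, w⟩, v, b⟩ ⟨⟨j', a', w'⟩, v', b'⟩ h
        simp only [Prod.mk.injEq, EmbeddingLike.apply_eq_iff_eq, Subtype.ext_iff] at h ⊢
        obtain ⟨⟨hj, h⟩, hv⟩ := h
        obtain ⟨ha, h⟩ := Prod.mk.inj h
        obtain ⟨hb, hw⟩ := Prod.mk.inj h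
        exact ⟨⟨hj, ha, hw⟩, hv, hb⟩)
  have hdim : Module.finrank ℂ (Qudits r (N + e)) ≤ Module.finrank ℂ
      (EuclideanSpace ℂ ((Fin N → ZMod r) × Fin (e + 1) × Fin (M))) := by
    have hr : 0 < r := (Fact.out : r.Prime).pos
    simp only [finrank_euclideanSpace, hM, Fintype.card_prod, Fintype.card_fun, ZMod.card,
      Fintype.card_fin, Env]
    rw [pow_add]
    refine Nat.mul_le_mul_left _ ?_
    calc r ^ e = 1 * (1 * (1 * r ^ e)) := by ring
      _ ≤ (e + 1) * (r ^ N * (r ^ n * r ^ e)) := by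
        gcongr
        · omega
        · exact Nat.one_le_pow _ _ hr
        · exact Nat.one_le_pow _ _ hr
  obtain ⟨V, hV⟩ := exists_linearIsometry_of_orthonormal hdim hsrc htgt
  refine ⟨M, V, fun j a b χ ha hb => ?_⟩
  have hb' : hammingNorm (foldPhase b : Fin n → ZMod r) ≤ tZ :=
    (hammingNorm_foldPhase_le b).trans hb
  refine ⟨∑ w, χ w • EuclideanSpace.single (enc (a, foldPhase b, w)) 1, ?_⟩
  set φ : EuclideanSpace ℂ (Fin (M)) :=
    ∑ w, χ w • EuclideanSpace.single (enc (a, foldPhase b, w)) 1 with hφdef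
  -- both sides are linear in the encoded state
  let L : Qudits r N →ₗ[ℂ]
      EuclideanSpace ℂ ((Fin N → ZMod r) × Fin (e + 1) × Fin (M)) :=
    V.toLinearMap ∘ₗ
      { toFun := fun ψ => inStream j (pauliError a b ψ) χ
        map_add' := fun x y => by
          ext p
          simp only [inStream, pauliError, PiLp.add_apply]
          ring
        map_smul' := fun z x => by
          ext p
          simp only [inStream, pauliError, PiLp.smul_apply, smul_eq_mul, RingHom.id_apply]
          ring }
  let R : Qudits r N →ₗ[ℂ]
      EuclideanSpace ℂ ((Fin N → ZMod r) × Fin (e + 1) × Fin (M)) :=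
    { toFun := fun ψ => WithLp.toLp 2 fun x => if x.2.1 = j then ψ x.1 * φ x.2.2 else 0
      map_add' := fun x y => by
        ext p
        simp only [PiLp.add_apply]
        split_ifs <;> ring
      map_smul' := fun z x => by
        ext p
        simp only [PiLp.smul_apply, smul_eq_mul, RingHom.id_apply]
        split_ifs <;> ring }
  suffices h : Set.EqOn L R (Set.range ψ) from fun x hx => LinearMap.eqOn_span h hx
  rintro _ ⟨v, rfl⟩
  change V (inStream j (pauliError a b (ψ v)) χ) =
    WithLp.toLp 2 fun x => if x.2.1 = j then ψ v x.1 * φ x.2.2 else 0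
  have hterm : ∀ w, V (inStream j (pauliError a b (ψ v)) (EuclideanSpace.single w 1)) =
      tgt' ((j, enc (a, foldPhase b, w)), v) := by
    intro w
    rw [pauliError_relabel, inStream_relabel]
    exact hV ((j, ⟨a, ha⟩, w), v, ⟨foldPhase b, hb'⟩)
  rw [inStream_single, map_sum]
  simp only [map_smul, hterm]
  ext ⟨x, j', k⟩
  simp only [WithLp.ofLp_sum, Finset.sum_apply, PiLp.smul_apply, smul_eq_mul, tgt', relabel_apply,
    ψ, hφdef, PiLp.single_apply, Prod.mk.injEq]
  by_cases hj : j' = j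
  · subst hj
    rw [if_pos rfl, Finset.mul_sum]
    refine Finset.sum_congr rfl fun w _ => ?_
    by_cases hk : k = enc (a, foldPhase b, w)
    · simp [hk, mul_comm]
    · simp [hk]
  · simp [hj]

/-! ### Cyclic codes and their zeros -/

section Cyclic

variable {F : Type*} [Field F]

/-- The polynomial `c_0 + c_1 x + ⋯ + c_{n-1} x ^ (n - 1)` of a word. -/
noncomputable def wordPoly {n : ℕ} : (Fin n → F) →ₗ[F] F[X] :=
  ∑ i : Fin n, (Polynomial.monomial (R := F) (i : ℕ)).comp (LinearMap.proj i)

theorem wordPoly_apply {n : ℕ} (c : Fin n → F) :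
    wordPoly c = ∑ i : Fin n, monomial (i : ℕ) (c i) := by
  simp [wordPoly]

theorem aeval_wordPoly {K : Type*} [Field K] [Algebra F K] {n : ℕ} (c : Fin n → F) (x : K) :
    aeval x (wordPoly c) = ∑ i : Fin n, algebraMap F K (c i) * x ^ (i : ℕ) := by
  simp [wordPoly_apply, aeval_monomial]

theorem wordPoly_coeff {n : ℕ} {g : F[X]} (hg : g.natDegree < n) :
    wordPoly (fun i : Fin n => g.coeff i) = g := by
  rw [wordPoly_apply, Fin.sum_univ_eq_sum_range fun i => monomial i (g.coeff i)]
  exact (g.as_sum_range' n hg).symm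

theorem mem_cyclicCode_iff {n : ℕ} {g : F[X]} (hg : g ∣ X ^ n - 1) (c : Fin n → F) :
    c ∈ cyclicCode n g ↔ g ∣ wordPoly c := by
  change wordPoly c ∈ Ideal.span {g, X ^ n - 1} ↔ _
  rw [Ideal.mem_span_pair]
  constructor
  · rintro ⟨a, b, h⟩
    exact h ▸ dvd_add (dvd_mul_left _ _) (hg.mul_left _)
  · rintro ⟨a, h⟩
    exact ⟨a, 0, by rw [h]; ring⟩

theorem finrank_cyclicCode {n : ℕ} (hn : n ≠ 0) {g : F[X]} (hg : g ∣ X ^ n - 1) :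
    Module.finrank F (cyclicCode n g) + g.natDegree = n := by
  have hX : (X ^ n - 1 : F[X]) ≠ 0 := by
    simpa using X_pow_sub_C_ne_zero (Nat.pos_of_ne_zero hn) (1 : F)
  have hg0 : g ≠ 0 := fun h => hX (zero_dvd_iff.1 (h ▸ hg))
  have hle : g.natDegree ≤ n := by
    have := natDegree_le_of_dvd hg hX
    rwa [← C_1, natDegree_X_pow_sub_C] at this
  let φ : (Fin n → F) →ₗ[F] F[X] ⧸ Ideal.span {g} :=
    (Ideal.Quotient.mkₐ F (Ideal.span {g})).toLinearMap ∘ₗ wordPoly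
  have hker : LinearMap.ker φ = cyclicCode n g := by
    ext c
    rw [mem_cyclicCode_iff hg, LinearMap.mem_ker, ← Ideal.mem_span_singleton]
    exact Ideal.Quotient.eq_zero_iff_mem
  have hsurj : Function.Surjective φ := by
    intro y
    obtain ⟨p, rfl⟩ := Ideal.Quotient.mk_surjective y
    refine ⟨fun i => (p % g).coeff i, ?_⟩
    change Ideal.Quotient.mk _ (wordPoly fun i : Fin n => (p % g).coeff i) = _
    have hmod : wordPoly (fun i : Fin n => (p % g).coeff i) = p % g := by
      by_cases hdeg : g.natDegree = 0
      · have : p % g = 0 := by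
          rw [EuclideanDomain.mod_eq_zero]
          exact (isUnit_iff_degree_eq_zero.2
            ((degree_eq_iff_natDegree_eq hg0).2 hdeg)).dvd
        rw [this]
        simp [wordPoly_apply]
      · exact wordPoly_coeff ((natDegree_mod_lt p hdeg).trans_le hle)
    rw [hmod, Ideal.Quotient.eq, Ideal.mem_span_singleton]
    exact ⟨-(p / g), by linear_combination EuclideanDomain.div_add_mod p g⟩
  have h := φ.finrank_range_add_finrank_ker
  rw [hker, LinearMap.range_eq_top.2 hsurj, finrank_top, finrank_quotient_span_eq_natDegree,
    Module.finrank_fin_fun] at h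
  omega

section Zeros

variable {K : Type*} [Field K] [Algebra F K] {n : ℕ} [NeZero n]

theorem aeval_wordPoly_shift {x : K} (hx : x ^ n = 1) (y : Fin n → F) (k : Fin n) :
    x ^ (k : ℕ) * aeval x (wordPoly fun i => y (i + k)) = aeval x (wordPoly y) := by
  rw [aeval_wordPoly, aeval_wordPoly, Finset.mul_sum,
    ← Equiv.sum_comp (Equiv.addRight k) fun i => algebraMap F K (y i) * x ^ (i : ℕ)]
  refine Finset.sum_congr rfl fun i _ => ?_
  have : x ^ ((i + k : Fin n) : ℕ) = x ^ (i : ℕ) * x ^ (k : ℕ) := by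
    rw [Fin.val_add, ← pow_add]
    exact (pow_eq_pow_mod _ hx).symm
  rw [Equiv.coe_addRight, this]
  ring

/-- If `d` is orthogonal to all cyclic shifts of `c`, then `d(1/x) c(x) = 0` for every `n`-th root
of unity `x`: the zeros of the dual code are the inverses of the non-zeros. -/
theorem aeval_inv_mul_aeval_eq_zero {C : Submodule F (Fin n → F)}
    (hC : ∀ y ∈ C, ∀ k : Fin n, (fun i => y (i + k)) ∈ C) {d c : Fin n → F}
    (hd : d ∈ dualCode C) (hc : c ∈ C) {x : K} (hx : x ^ n = 1) :
    aeval x⁻¹ (wordPoly d) * aeval x (wordPoly c) = 0 := by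
  have hx0 : x ≠ 0 := by
    rintro rfl
    rw [zero_pow (NeZero.ne n)] at hx
    exact zero_ne_one hx
  calc aeval x⁻¹ (wordPoly d) * aeval x (wordPoly c)
      = ∑ i : Fin n, algebraMap F K (d i) * aeval x (wordPoly fun k => c (k + i)) := by
        rw [aeval_wordPoly, Finset.sum_mul]
        refine Finset.sum_congr rfl fun i _ => ?_
        rw [← aeval_wordPoly_shift hx c i, inv_pow]
        field_simp
    _ = ∑ k : Fin n, x ^ (k : ℕ) * algebraMap F K (d ⬝ᵥ fun i => c (i + k)) := by
        simp only [aeval_wordPoly, Finset.mul_sum, dotProduct, map_sum, map_mul]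
        rw [Finset.sum_comm]
        refine Finset.sum_congr rfl fun k _ => Finset.sum_congr rfl fun i _ => ?_
        rw [add_comm k i]
        ring
    _ = 0 := Finset.sum_eq_zero fun k _ => by rw [hd _ (hC c hc k), map_zero, mul_zero]

end Zeros

theorem pow_val_add {K : Type*} [Field K] {n : ℕ} [NeZero n] {η : K} (hη : η ^ n = 1)
    (a b : ZMod n) : η ^ (a + b).val = η ^ a.val * η ^ b.val := by
  rw [ZMod.val_add, ← pow_eq_pow_mod _ hη, pow_add]

theorem pow_val_mul_natCast {K : Type*} [Field K] {n : ℕ} [NeZero n] {η : K} (hη : η ^ n = 1)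
    (a : ZMod n) (k : ℕ) : η ^ (a * k).val = (η ^ a.val) ^ k := by
  rw [ZMod.val_mul, ← pow_eq_pow_mod _ hη, ZMod.val_natCast, ← pow_mul, pow_eq_pow_mod _ hη,
    Nat.mul_mod_mod, ← pow_eq_pow_mod _ hη]

theorem pow_val_pow_eq_one {K : Type*} [Field K] {n : ℕ} {η : K} (hη : η ^ n = 1) (a : ZMod n) :
    (η ^ a.val) ^ n = 1 := by
  rw [← pow_mul, mul_comm, pow_mul, hη, one_pow]

section RootsPoly

variable {K : Type*} [Field K] {n : ℕ} {η : K}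

theorem rootsPoly_monic (A : Finset (ZMod n)) : (rootsPoly η A).Monic :=
  monic_prod_of_monic _ _ fun _ _ => monic_X_sub_C _

theorem natDegree_rootsPoly (A : Finset (ZMod n)) : (rootsPoly η A).natDegree = A.card := by
  rw [rootsPoly, natDegree_prod_of_monic _ _ fun _ _ => monic_X_sub_C _]
  simp only [natDegree_X_sub_C, Finset.sum_const, smul_eq_mul, mul_one]

theorem natDegree_of_map_eq_rootsPoly {F : Type*} [Field F] [Algebra F K] {g : F[X]}
    {A : Finset (ZMod n)} (hg : g.map (algebraMap F K) = rootsPoly η A) :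
    g.natDegree = A.card := by
  rw [← natDegree_rootsPoly (η := η), ← hg, natDegree_map]

variable [NeZero n]

theorem pow_val_injective (hη : IsPrimitiveRoot η n) :
    Function.Injective fun a : ZMod n => η ^ a.val := fun a b h =>
  ZMod.val_injective n (hη.pow_inj (ZMod.val_lt a) (ZMod.val_lt b) h)

theorem eval_rootsPoly_eq_zero_iff (hη : IsPrimitiveRoot η n) (A : Finset (ZMod n)) (t : ZMod n) :
    (rootsPoly η A).eval (η ^ t.val) = 0 ↔ t ∈ A := by
  rw [rootsPoly, eval_prod, Finset.prod_eq_zero_iff]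
  constructor
  · rintro ⟨a, ha, h⟩
    rw [eval_sub, eval_X, eval_C, sub_eq_zero] at h
    exact pow_val_injective hη h ▸ ha
  · exact fun h => ⟨t, h, by simp⟩

theorem rootsPoly_dvd_iff (hη : IsPrimitiveRoot η n) (A : Finset (ZMod n)) (p : K[X]) :
    rootsPoly η A ∣ p ↔ ∀ t ∈ A, p.eval (η ^ t.val) = 0 := by
  constructor
  · rintro ⟨p, rfl⟩ t ht
    rw [eval_mul, (eval_rootsPoly_eq_zero_iff hη A t).2 ht, zero_mul]
  · intro h
    refine Finset.prod_dvd_of_coprime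
      ((pairwise_coprime_X_sub_C (pow_val_injective hη)).set_pairwise _) fun t ht => ?_
    exact dvd_iff_isRoot.2 (h t ht)

theorem rootsPoly_dvd_X_pow_sub_one (hη : IsPrimitiveRoot η n) (A : Finset (ZMod n)) :
    rootsPoly η A ∣ X ^ n - 1 := by
  rw [rootsPoly_dvd_iff hη]
  intro t _
  simp [pow_val_pow_eq_one hη.pow_eq_one]

variable {F : Type*} [Field F] [Algebra F K] {g : F[X]} {A : Finset (ZMod n)}

theorem dvd_X_pow_sub_one_of_map_eq_rootsPoly (hη : IsPrimitiveRoot η n)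
    (hg : g.map (algebraMap F K) = rootsPoly η A) : g ∣ X ^ n - 1 := by
  rw [← map_dvd_map' (algebraMap F K), hg]
  simpa using rootsPoly_dvd_X_pow_sub_one hη A

theorem aeval_eq_zero_iff_of_map_eq_rootsPoly (hη : IsPrimitiveRoot η n)
    (hg : g.map (algebraMap F K) = rootsPoly η A) (t : ZMod n) :
    aeval (η ^ t.val) g = 0 ↔ t ∈ A := by
  rw [← eval_map_algebraMap, hg, eval_rootsPoly_eq_zero_iff hη]

theorem mem_cyclicCode_iff_aeval (hη : IsPrimitiveRoot η n)
    (hg : g.map (algebraMap F K) = rootsPoly η A) (c : Fin n → F) :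
    c ∈ cyclicCode n g ↔ ∀ t ∈ A, aeval (η ^ t.val) (wordPoly c) = 0 := by
  rw [mem_cyclicCode_iff (dvd_X_pow_sub_one_of_map_eq_rootsPoly hη hg),
    ← map_dvd_map' (algebraMap F K), hg, rootsPoly_dvd_iff hη]
  simp only [eval_map_algebraMap]

theorem shift_mem_cyclicCode (hη : IsPrimitiveRoot η n)
    (hg : g.map (algebraMap F K) = rootsPoly η A) {y : Fin n → F} (hy : y ∈ cyclicCode n g)
    (k : Fin n) : (fun i => y (i + k)) ∈ cyclicCode n g := by
  rw [mem_cyclicCode_iff_aeval hη hg] at hy ⊢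
  intro t ht
  have h := aeval_wordPoly_shift (pow_val_pow_eq_one hη.pow_eq_one t) y k
  rw [hy t ht] at h
  exact (mul_eq_zero.1 h).resolve_left
    (pow_ne_zero _ (pow_ne_zero _ (hη.ne_zero (NeZero.ne n))))

/-- A cyclic code contains its dual if its zeros are disjoint from their inverses. -/
theorem dualCode_cyclicCode_le (hη : IsPrimitiveRoot η n)
    (hg : g.map (algebraMap F K) = rootsPoly η A) (hA : ∀ t ∈ A, -t ∉ A) :
    dualCode (cyclicCode n g) ≤ cyclicCode n g := by
  intro d hd
  rw [mem_cyclicCode_iff_aeval hη hg]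
  intro t ht
  have h0 : (0 : ZMod n) ∉ A := fun h => hA 0 h (by rwa [neg_zero])
  have hdeg : g.natDegree < n := by
    rw [natDegree_of_map_eq_rootsPoly hg]
    exact (Finset.card_lt_univ_of_notMem h0).trans_eq (ZMod.card n)
  have hgmem : (fun i : Fin n => g.coeff i) ∈ cyclicCode n g := by
    rw [mem_cyclicCode_iff (dvd_X_pow_sub_one_of_map_eq_rootsPoly hη hg), wordPoly_coeff hdeg]
  have h := aeval_inv_mul_aeval_eq_zero
    (fun y hy k => shift_mem_cyclicCode hη hg hy k) hd hgmem
    (pow_val_pow_eq_one hη.pow_eq_one (-t))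
  have hinv : (η ^ (-t).val)⁻¹ = η ^ t.val := by
    refine inv_eq_of_mul_eq_one_right ?_
    rw [← pow_val_add hη.pow_eq_one, neg_add_cancel, ZMod.val_zero, pow_zero]
  rw [wordPoly_coeff hdeg, hinv] at h
  exact (mul_eq_zero.1 h).resolve_right
    fun h' => hA t ht ((aeval_eq_zero_iff_of_map_eq_rootsPoly hη hg _).1 h')

theorem finrank_cyclicCode_of_map_eq_rootsPoly (hη : IsPrimitiveRoot η n)
    (hg : g.map (algebraMap F K) = rootsPoly η A) :
    Module.finrank F (cyclicCode n g) + A.card = n := by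
  rw [← natDegree_of_map_eq_rootsPoly hg]
  exact finrank_cyclicCode (NeZero.ne n) (dvd_X_pow_sub_one_of_map_eq_rootsPoly hη hg)

/-- The shifts of a word `u` by less than `n` places are distinct modulo a code with a zero of order
`n` at which `u` does not vanish. -/
theorem eq_of_shift_sub_shift_mem (hη : IsPrimitiveRoot η n)
    (hg : g.map (algebraMap F K) = rootsPoly η A) {t : ZMod n} (ht : t ∈ A) (hunit : IsUnit t)
    {u : Fin n → F} (hu : aeval (η ^ t.val) (wordPoly u) ≠ 0) {k k' : ℕ} (hk : k < n)
    (hk' : k' < n)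
    (h : (fun i => u (i + Fin.ofNat n k) - u (i + Fin.ofNat n k')) ∈ cyclicCode n g) : k = k' := by
  have hx : IsPrimitiveRoot (η ^ t.val) n :=
    hη.pow_of_coprime _ ((ZMod.isUnit_iff_coprime _ _).1 (by rwa [ZMod.natCast_zmod_val]))
  have h0 := (mem_cyclicCode_iff_aeval hη hg _).1 h t ht
  set x := η ^ t.val with hxdef
  have e1 := aeval_wordPoly_shift hx.pow_eq_one u (Fin.ofNat n k)
  have e2 := aeval_wordPoly_shift hx.pow_eq_one u (Fin.ofNat n k')
  have hsub : aeval x (wordPoly fun i => u (i + Fin.ofNat n k)) =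
      aeval x (wordPoly fun i => u (i + Fin.ofNat n k')) := by
    rw [← sub_eq_zero, ← map_sub, ← map_sub]
    exact h0
  simp only [Fin.val_ofNat, Nat.mod_eq_of_lt hk, Nat.mod_eq_of_lt hk'] at e1 e2
  rw [hsub, ← e2] at e1
  refine hx.pow_inj hk hk' (mul_right_cancel₀ ?_ e1)
  intro hz
  rw [hz, mul_zero] at e2
  exact hu e2.symm

end RootsPoly

end Cyclic

/-! ### Cyclotomic cosets and minimal polynomials -/

section Cosets

variable {r : ℕ} [Fact r.Prime] {K : Type*} [Field K] [Algebra (ZMod r) K] {n : ℕ} [NeZero n]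
  {η : K}

/-- If the exponents are closed under multiplication by `r`, the product is fixed by the Frobenius
map and hence has coefficients in the prime field. -/
theorem exists_map_eq_rootsPoly (hη : IsPrimitiveRoot η n) (hr : IsUnit (r : ZMod n))
    {A : Finset (ZMod n)} (hA : ∀ a ∈ A, a * r ∈ A) :
    ∃ g : (ZMod r)[X], g.map (algebraMap (ZMod r) K) = rootsPoly η A := by
  have : CharP K r := charP_of_injective_algebraMap (algebraMap (ZMod r) K).injective r
  have himage : A.image (fun a => a * (r : ZMod n)) = A := by
    refine Finset.eq_of_subset_of_card_le (Finset.image_subset_iff.2 hA) ?_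
    rw [Finset.card_image_of_injective _ hr.mul_left_injective]
  have hfrob : (rootsPoly η A).map (frobenius K r) = rootsPoly η A := by
    conv_rhs => rw [← himage]
    rw [rootsPoly, rootsPoly, Polynomial.map_prod,
      Finset.prod_image fun a _ b _ h => hr.mul_left_injective h]
    refine Finset.prod_congr rfl fun a _ => ?_
    rw [Polynomial.map_sub, map_X, map_C, frobenius_def, pow_val_mul_natCast hη.pow_eq_one]
  refine (mem_lifts _).1 ((lifts_iff_coeff_lifts _).2 fun i => ?_)
  have hi : (rootsPoly η A).coeff i ^ r = (rootsPoly η A).coeff i := by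
    conv_rhs => rw [← hfrob, coeff_map, frobenius_def]
  have hbot := (Subfield.mem_bot_iff_pow_eq_self K r).2 hi
  exact (bot_le : (⊥ : Subfield K) ≤ (algebraMap (ZMod r) K).fieldRange) hbot

/-- The `r`-cyclotomic coset of `t` modulo `n`, as a finite set. -/
noncomputable def cosetFinset (r : ℕ) {n : ℕ} (t : ZMod n) : Finset (ZMod n) :=
  (Finset.range (orderOf (r : ZMod n))).image fun s => t * (r : ZMod n) ^ s

theorem orderOf_pos_of_isUnit {n : ℕ} {a : ZMod n} (ha : IsUnit a) : 0 < orderOf a := by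
  obtain ⟨u, rfl⟩ := ha
  rw [orderOf_units]
  exact orderOf_pos u

theorem mem_cosetFinset {r n : ℕ} (hr : IsUnit (r : ZMod n)) {t a : ZMod n} :
    a ∈ cosetFinset r t ↔ a ∈ cyclotomicCoset r n t := by
  have hpos := orderOf_pos_of_isUnit hr
  simp only [cosetFinset, Finset.mem_image, Finset.mem_range]
  constructor
  · rintro ⟨s, _, rfl⟩
    exact ⟨s, rfl⟩
  · rintro ⟨s, rfl⟩
    exact ⟨s % orderOf (r : ZMod n), Nat.mod_lt _ hpos, by rw [pow_mod_orderOf]⟩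

theorem map_minimalPoly (hη : IsPrimitiveRoot η n) (hr : IsUnit (r : ZMod n)) (t : ZMod n) :
    (minimalPoly r η t).map (algebraMap (ZMod r) K) = rootsPoly η (cosetFinset r t) := by
  obtain ⟨g, hg⟩ := exists_map_eq_rootsPoly (A := cosetFinset r t) hη hr (by
    intro a ha
    rw [mem_cosetFinset hr] at ha ⊢
    obtain ⟨s, rfl⟩ := ha
    exact ⟨s + 1, by ring⟩)
  have hgmonic : g.Monic :=
    monic_of_injective (algebraMap (ZMod r) K).injective (hg ▸ rootsPoly_monic _)
  have hgt : aeval (η ^ t.val) g = 0 :=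
    (aeval_eq_zero_iff_of_map_eq_rootsPoly hη hg t).2
      ((mem_cosetFinset hr).2 ⟨0, by simp⟩)
  have hint : IsIntegral (ZMod r) (η ^ t.val) := ⟨g, hgmonic, hgt⟩
  have hdvd : g ∣ minpoly (ZMod r) (η ^ t.val) := by
    rw [← map_dvd_map' (algebraMap (ZMod r) K), hg, rootsPoly_dvd_iff hη]
    intro a ha
    obtain ⟨s, rfl⟩ := (mem_cosetFinset hr).1 ha
    rw [eval_map_algebraMap]
    have hs : ∀ s : ℕ, aeval (η ^ (t * (r : ZMod n) ^ s).val)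
        (minpoly (ZMod r) (η ^ t.val)) = 0 := by
      intro s
      induction s with
      | zero => simp
      | succ s ih =>
        rw [pow_succ, ← mul_assoc, pow_val_mul_natCast hη.pow_eq_one, ← expand_aeval,
          ZMod.expand_card, map_pow, ih, zero_pow (Fact.out : r.Prime).ne_zero]
    exact hs s
  rw [minimalPoly, ← hg, eq_of_monic_of_associated (minpoly.monic hint) hgmonic
    (associated_of_dvd_dvd (minpoly.dvd _ _ hgt) hdvd)]

end Cosets

/-! ### Representatives of cyclotomic cosets -/

section Representatives

variable {r n : ℕ}

theorem mem_cyclotomicCoset_trans {a b c : ZMod n} (h : a ∈ cyclotomicCoset r n b)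
    (h' : b ∈ cyclotomicCoset r n c) : a ∈ cyclotomicCoset r n c := by
  obtain ⟨s, rfl⟩ := h
  obtain ⟨s', rfl⟩ := h'
  exact ⟨s' + s, by ring⟩

theorem cosetFinset_subset (hr : IsUnit (r : ZMod n)) {A : Finset (ZMod n)}
    (hA : ∀ a ∈ A, a * r ∈ A) {t : ZMod n} (ht : t ∈ A) : cosetFinset r t ⊆ A := by
  intro a ha
  obtain ⟨s, rfl⟩ := (mem_cosetFinset hr).1 ha
  have hs : ∀ s : ℕ, t * (r : ZMod n) ^ s ∈ A := by
    intro s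
    induction s with
    | zero => simpa using ht
    | succ s ih =>
      rw [pow_succ, ← mul_assoc]
      exact hA _ ih
  exact hs s

theorem mem_cyclotomicCoset_symm (hr : IsUnit (r : ZMod n)) {a t : ZMod n}
    (h : a ∈ cyclotomicCoset r n t) : t ∈ cyclotomicCoset r n a := by
  obtain ⟨s, rfl⟩ := h
  have hpos := orderOf_pos_of_isUnit hr
  refine ⟨s * (orderOf (r : ZMod n) - 1), ?_⟩
  rw [mul_assoc, ← pow_add,
    show s + s * (orderOf (r : ZMod n) - 1) = orderOf (r : ZMod n) * s by
      obtain ⟨k, hk⟩ := Nat.exists_eq_succ_of_ne_zero hpos.ne'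
      rw [hk, Nat.succ_eq_add_one, Nat.add_sub_cancel]
      ring,
    pow_mul, pow_orderOf_eq_one, one_pow, mul_one]

theorem exists_isCosetRepresentatives (hr : IsUnit (r : ZMod n)) {A : Finset (ZMod n)}
    (hA : ∀ a ∈ A, a * r ∈ A) : ∃ T, IsCosetRepresentatives r n A T := by
  let st : Setoid (ZMod n) :=
    { r := fun a b => b ∈ cyclotomicCoset r n a
      iseqv := ⟨fun a => ⟨0, by simp⟩, fun h => mem_cyclotomicCoset_symm hr h,
        fun h h' => mem_cyclotomicCoset_trans h' h⟩ }
  have hout : ∀ a : ZMod n, a ∈ cyclotomicCoset r n (Quotient.mk st a).out := fun a =>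
    Quotient.exact (Quotient.out_eq (Quotient.mk st a))
  refine ⟨A.image fun a => (Quotient.mk st a).out, ?_, ?_⟩
  · intro t ht
    obtain ⟨a, ha, rfl⟩ := Finset.mem_image.1 ht
    exact cosetFinset_subset hr hA ha
      ((mem_cosetFinset hr).2 (mem_cyclotomicCoset_symm hr (hout a)))
  · intro a ha
    refine ⟨_, ⟨Finset.mem_image_of_mem _ ha, hout a⟩, ?_⟩
    rintro t ⟨ht, hat⟩
    obtain ⟨b, hb, rfl⟩ := Finset.mem_image.1 ht
    have : Quotient.mk st b = Quotient.mk st a :=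
      Quotient.sound (mem_cyclotomicCoset_trans hat (mem_cyclotomicCoset_symm hr (hout b)))
    rw [this]

variable {A T : Finset (ZMod n)}

theorem IsCosetRepresentatives.pairwiseDisjoint (hT : IsCosetRepresentatives r n A T)
    (hr : IsUnit (r : ZMod n)) (hA : ∀ a ∈ A, a * r ∈ A) {S : Finset (ZMod n)} (hS : S ⊆ T) :
    (S : Set (ZMod n)).PairwiseDisjoint (cosetFinset r) := by
  intro t ht t' ht' hne
  refine Finset.disjoint_left.2 fun a ha ha' => hne ?_
  have haA := cosetFinset_subset hr hA (hT.1 (hS ht)) ha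
  exact (hT.2 a haA).unique ⟨hS ht, (mem_cosetFinset hr).1 ha⟩
    ⟨hS ht', (mem_cosetFinset hr).1 ha'⟩

theorem IsCosetRepresentatives.biUnion_subset (hT : IsCosetRepresentatives r n A T)
    (hr : IsUnit (r : ZMod n)) (hA : ∀ a ∈ A, a * r ∈ A) {S : Finset (ZMod n)} (hS : S ⊆ T) :
    S.biUnion (cosetFinset r) ⊆ A :=
  Finset.biUnion_subset.2 fun _ ht => cosetFinset_subset hr hA (hT.1 (hS ht))

theorem IsCosetRepresentatives.biUnion_eq (hT : IsCosetRepresentatives r n A T)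
    (hr : IsUnit (r : ZMod n)) (hA : ∀ a ∈ A, a * r ∈ A) : T.biUnion (cosetFinset r) = A := by
  refine (hT.biUnion_subset hr hA subset_rfl).antisymm fun a ha => ?_
  obtain ⟨t, ⟨ht, hat⟩, _⟩ := hT.2 a ha
  exact Finset.mem_biUnion.2 ⟨t, ht, (mem_cosetFinset hr).2 hat⟩

theorem IsCosetRepresentatives.card_biUnion (hT : IsCosetRepresentatives r n A T)
    (hr : IsUnit (r : ZMod n)) (hA : ∀ a ∈ A, a * r ∈ A) {ℓ : ℕ}
    (hcard : ∀ t ∈ A, (cosetFinset r t).card = ℓ) {S : Finset (ZMod n)} (hS : S ⊆ T) :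
    (S.biUnion (cosetFinset r)).card = S.card * ℓ := by
  rw [Finset.card_biUnion fun t ht t' ht' h => hT.pairwiseDisjoint hr hA hS ht ht' h,
    Finset.sum_congr rfl fun t ht => hcard t (hT.1 (hS ht)), Finset.sum_const, smul_eq_mul]

theorem sdiff_biUnion_cosetFinset_closed (hr : IsUnit (r : ZMod n)) (hA : ∀ a ∈ A, a * r ∈ A)
    (S : Finset (ZMod n)) :
    ∀ a ∈ A \ S.biUnion (cosetFinset r), a * r ∈ A \ S.biUnion (cosetFinset r) := by
  intro a ha
  obtain ⟨ha, hS⟩ := Finset.mem_sdiff.1 ha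
  refine Finset.mem_sdiff.2 ⟨hA a ha, fun h => hS ?_⟩
  obtain ⟨t, ht, hat⟩ := Finset.mem_biUnion.1 h
  refine Finset.mem_biUnion.2 ⟨t, ht, (mem_cosetFinset hr).2 ?_⟩
  exact mem_cyclotomicCoset_trans (mem_cyclotomicCoset_symm hr ⟨1, by rw [pow_one]⟩)
    ((mem_cosetFinset hr).1 hat)

/-- Removing the cosets of `S` from the zeros divides the generator polynomial by the minimal
polynomials belonging to `S`. -/
theorem IsCosetRepresentatives.exists_generator [NeZero n] [Fact r.Prime] {K : Type*} [Field K]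
    [Algebra (ZMod r) K] {η : K} (hη : IsPrimitiveRoot η n)
    (hT : IsCosetRepresentatives r n A T) (hr : IsUnit (r : ZMod n)) (hA : ∀ a ∈ A, a * r ∈ A)
    {G : (ZMod r)[X]} (hG : G.map (algebraMap (ZMod r) K) = rootsPoly η A)
    {S : Finset (ZMod n)} (hS : S ⊆ T) :
    ∃ g : (ZMod r)[X],
      g.map (algebraMap (ZMod r) K) = rootsPoly η (A \ S.biUnion (cosetFinset r)) ∧
        G = g * ∏ t ∈ S, minimalPoly r η t := by
  obtain ⟨g, hg⟩ := exists_map_eq_rootsPoly hη hr (sdiff_biUnion_cosetFinset_closed hr hA S)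
  refine ⟨g, hg, map_injective _ (algebraMap (ZMod r) K).injective ?_⟩
  rw [Polynomial.map_mul, hG, hg, Polynomial.map_prod,
    Finset.prod_congr rfl fun t _ => map_minimalPoly hη hr t]
  simp only [rootsPoly]
  rw [← Finset.prod_biUnion (hT.pairwiseDisjoint hr hA hS),
    Finset.prod_sdiff (hT.biUnion_subset hr hA hS)]

end Representatives

/-! ### The classes `D_i` and `E_j` -/

section Classes

variable {q g : ℕ}

theorem isUnit_of_isCommonPrimitiveRoot (hq : 1 < q) (hg : IsCommonPrimitiveRoot q g) :
    IsUnit (g : ZMod (2 * q)) :=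
  IsUnit.of_pow_eq_one (pow_orderOf_eq_one _) (by rw [hg.2]; omega)

theorem mem_classD_iff (hq : q % 2 = 1) (hq1 : 1 < q) (hg : IsCommonPrimitiveRoot q g) (i : Fin 2)
    {x : ZMod (2 * q)} :
    x ∈ classD q g i ↔ ∃ s : ℕ, x = (g : ZMod (2 * q)) ^ (2 * s + (i : ℕ)) := by
  simp only [classD, Finset.mem_image, Finset.mem_range]
  constructor
  · rintro ⟨s, _, rfl⟩
    exact ⟨s, rfl⟩
  · rintro ⟨s, rfl⟩
    refine ⟨s % ((q - 1) / 2), Nat.mod_lt _ (by omega), ?_⟩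
    have h2 : 2 * ((q - 1) / 2) = q - 1 := by omega
    have h1 : (g : ZMod (2 * q)) ^ (2 * ((q - 1) / 2)) = 1 := by
      rw [h2, ← hg.2, pow_orderOf_eq_one]
    conv_rhs => rw [← Nat.div_add_mod s ((q - 1) / 2)]
    rw [mul_add, ← mul_assoc, add_assoc, pow_add _ (2 * _ * _), pow_mul, h1, one_pow, one_mul]

theorem card_classD (hg : IsCommonPrimitiveRoot q g) (i : Fin 2) :
    (classD q g i).card = (q - 1) / 2 := by
  rw [classD, Finset.card_image_of_injOn, Finset.card_range]
  intro s hs s' hs' h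
  simp only [Finset.coe_range, Set.mem_Iio] at hs hs'
  have hi := i.2
  have := pow_injOn_Iio_orderOf (x := (g : ZMod (2 * q)))
    (by rw [Set.mem_Iio, hg.2]; omega) (by rw [Set.mem_Iio, hg.2]; omega) h
  omega

theorem isUnit_of_mem_classD (hq : 1 < q) (hg : IsCommonPrimitiveRoot q g) {i : Fin 2}
    {x : ZMod (2 * q)} (hx : x ∈ classD q g i) : IsUnit x := by
  obtain ⟨s, _, rfl⟩ := Finset.mem_image.1 hx
  exact (isUnit_of_isCommonPrimitiveRoot hq hg).pow _

/-- Although `2` is a zero divisor modulo `2q`, it can be cancelled between units: these are odd, so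
that their difference is even, and divisible by `q` if it is killed by `2`. -/
theorem eq_of_two_mul_eq (hq : q % 2 = 1) {a b : ZMod (2 * q)} (ha : IsUnit a) (hb : IsUnit b)
    (h : 2 * a = 2 * b) : a = b := by
  have : NeZero (2 * q) := ⟨by omega⟩
  have hodd : ∀ {x : ZMod (2 * q)}, IsUnit x → x.val % 2 = 1 := by
    intro x hx
    have hc := (ZMod.isUnit_iff_coprime x.val (2 * q)).1 (by rwa [ZMod.natCast_zmod_val])
    exact Nat.odd_iff.1 (Nat.coprime_two_right.1 (Nat.Coprime.coprime_mul_right_right hc))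
  have h1 := hodd ha
  have h2 := hodd hb
  have h3 : ((2 * a.val : ℕ) : ZMod (2 * q)) = ((2 * b.val : ℕ) : ZMod (2 * q)) := by
    push_cast
    rw [ZMod.natCast_zmod_val, ZMod.natCast_zmod_val, h]
  rw [ZMod.natCast_eq_natCast_iff] at h3
  have h4 : a.val ≡ b.val [MOD q] := Nat.ModEq.mul_left_cancel' two_ne_zero h3
  have h5 : a.val ≡ b.val [MOD 2 * q] :=
    (Nat.modEq_and_modEq_iff_modEq_mul (Nat.coprime_two_left.2 (Nat.odd_iff.2 hq))).1
      ⟨h1.trans h2.symm, h4⟩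
  exact ZMod.val_injective _ (Nat.ModEq.eq_of_lt_of_lt h5 (ZMod.val_lt a) (ZMod.val_lt b))

theorem not_isUnit_of_mem_classE {j : Fin 2} {x : ZMod (2 * q)}
    (hx : x ∈ classE q g j) : ¬IsUnit x := by
  obtain ⟨u, _, rfl⟩ := Finset.mem_image.1 hx
  intro h
  have h2 : IsUnit ((2 : ℕ) : ZMod (2 * q)) := by
    push_cast
    exact isUnit_of_mul_isUnit_left h
  have := (ZMod.isUnit_iff_coprime 2 (2 * q)).1 h2
  rw [Nat.coprime_mul_iff_right] at this
  exact absurd this.1 (by decide)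

theorem card_classE (hq : q % 2 = 1) (hq1 : 1 < q) (hg : IsCommonPrimitiveRoot q g) (j : Fin 2) :
    (classE q g j).card = (q - 1) / 2 := by
  rw [classE, Finset.card_image_of_injOn, card_classD hg]
  intro a ha b hb h
  exact eq_of_two_mul_eq hq (isUnit_of_mem_classD hq1 hg ha) (isUnit_of_mem_classD hq1 hg hb) h

theorem card_classD_union_classE (hq : q % 2 = 1) (hq1 : 1 < q) (hg : IsCommonPrimitiveRoot q g)
    (i j : Fin 2) : (classD q g i ∪ classE q g j).card = q - 1 := by
  rw [Finset.card_union_of_disjoint, card_classD hg, card_classE hq hq1 hg]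
  · omega
  · exact Finset.disjoint_left.2 fun x hx hx' =>
      not_isUnit_of_mem_classE hx' (isUnit_of_mem_classD hq1 hg hx)

/-- `-1` is not a square modulo `2q`, as `(q - 1) / 2` is odd. -/
theorem neg_notMem_classD (hq : q % 4 = 3) (hg : IsCommonPrimitiveRoot q g) {i : Fin 2}
    {x : ZMod (2 * q)} (hx : x ∈ classD q g i) : -x ∉ classD q g i := by
  intro hx'
  obtain ⟨s, _, rfl⟩ := Finset.mem_image.1 hx
  obtain ⟨s', _, h⟩ := Finset.mem_image.1 hx'
  have h1 : ∀ k : ℕ, ((g : ZMod (2 * q)) ^ (2 * k + (i : ℕ))) ^ ((q - 1) / 2) =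
      (g : ZMod (2 * q)) ^ ((i : ℕ) * ((q - 1) / 2)) := by
    intro k
    have h2 : 2 * ((q - 1) / 2) = q - 1 := by omega
    rw [← pow_mul, add_mul, pow_add, mul_right_comm, h2, pow_mul, ← hg.2, pow_orderOf_eq_one,
      one_pow, one_mul]
  have h2 := congrArg (· ^ ((q - 1) / 2)) h
  simp only [h1, Odd.neg_pow (Nat.odd_iff.2 (by omega : (q - 1) / 2 % 2 = 1))] at h2
  set y := (g : ZMod (2 * q)) ^ ((i : ℕ) * ((q - 1) / 2)) with hy
  have hu : IsUnit y := (isUnit_of_isCommonPrimitiveRoot (by omega) hg).pow _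
  have h3 : (1 : ZMod (2 * q)) = -1 := hu.mul_left_cancel (by rw [mul_one, mul_neg_one, ← h2])
  have h4 : ((2 : ℕ) : ZMod (2 * q)) = 0 := by
    push_cast
    linear_combination h3
  have := Nat.le_of_dvd two_pos ((ZMod.natCast_eq_zero_iff 2 (2 * q)).1 h4)
  omega

theorem neg_notMem_classD_union_classE (hq : q % 4 = 3) (hg : IsCommonPrimitiveRoot q g)
    (i j : Fin 2) : ∀ x ∈ classD q g i ∪ classE q g j, -x ∉ classD q g i ∪ classE q g j := by
  have hq1 : 1 < q := by omega
  intro x hx hx'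
  rcases Finset.mem_union.1 hx with hx | hx <;> rcases Finset.mem_union.1 hx' with hx' | hx'
  · exact neg_notMem_classD hq hg hx hx'
  · exact not_isUnit_of_mem_classE hx' (isUnit_of_mem_classD hq1 hg hx).neg
  · exact not_isUnit_of_mem_classE hx (neg_neg x ▸ (isUnit_of_mem_classD hq1 hg hx').neg)
  · obtain ⟨u, hu, rfl⟩ := Finset.mem_image.1 hx
    obtain ⟨u', hu', h⟩ := Finset.mem_image.1 hx'
    have := eq_of_two_mul_eq (by omega) (isUnit_of_mem_classD hq1 hg hu')
      (isUnit_of_mem_classD hq1 hg hu).neg (by rw [h, mul_neg])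
    exact neg_notMem_classD hq hg hu (this ▸ hu')

theorem mul_mem_classD (hq : q % 2 = 1) (hq1 : 1 < q) (hg : IsCommonPrimitiveRoot q g) {i : Fin 2}
    {x y : ZMod (2 * q)} (hx : x ∈ classD q g i) (hy : y ∈ classD q g 0) :
    x * y ∈ classD q g i := by
  rw [mem_classD_iff hq hq1 hg] at hx hy ⊢
  obtain ⟨s, rfl⟩ := hx
  obtain ⟨s', rfl⟩ := hy
  refine ⟨s + s', ?_⟩
  rw [← pow_add]
  congr 1
  simp only [Fin.coe_ofNat_eq_mod]
  omega

theorem mul_mem_classD_union_classE (hq : q % 2 = 1) (hq1 : 1 < q)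
    (hg : IsCommonPrimitiveRoot q g) {i j : Fin 2} {y : ZMod (2 * q)} (hy : y ∈ classD q g 0) :
    ∀ x ∈ classD q g i ∪ classE q g j, x * y ∈ classD q g i ∪ classE q g j := by
  intro x hx
  rcases Finset.mem_union.1 hx with hx | hx
  · exact Finset.mem_union_left _ (mul_mem_classD hq hq1 hg hx hy)
  · obtain ⟨u, hu, rfl⟩ := Finset.mem_image.1 hx
    refine Finset.mem_union_right _ (Finset.mem_image.2 ⟨u * y, mul_mem_classD hq hq1 hg hu hy, ?_⟩)
    rw [mul_assoc]

theorem card_cosetFinset (hq : q % 2 = 1) (hq1 : 1 < q) (hg : IsCommonPrimitiveRoot q g) {r : ℕ}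
    (hr : IsUnit (r : ZMod (2 * q))) {i j : Fin 2} {t : ZMod (2 * q)}
    (ht : t ∈ classD q g i ∪ classE q g j) :
    (cosetFinset r t).card = orderOf (r : ZMod (2 * q)) := by
  rw [cosetFinset, Finset.card_image_of_injOn, Finset.card_range]
  intro s hs s' hs' h
  simp only [Finset.coe_range] at hs hs'
  refine pow_injOn_Iio_orderOf hs hs' ?_
  rcases Finset.mem_union.1 ht with ht | ht
  · exact (isUnit_of_mem_classD hq1 hg ht).mul_left_cancel h
  · obtain ⟨u, hu, rfl⟩ := Finset.mem_image.1 ht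
    have hu := isUnit_of_mem_classD hq1 hg hu
    simp only [mul_assoc] at h
    exact hu.mul_left_cancel (eq_of_two_mul_eq hq (hu.mul (hr.pow s)) (hu.mul (hr.pow s')) h)

theorem two_mul_orderOf_dvd (hq : q % 2 = 1) (hg : IsCommonPrimitiveRoot q g)
    {y : ZMod (2 * q)} (hy : y ∈ classD q g 0) : 2 * orderOf y ∣ q - 1 := by
  have h2 : 2 * ((q - 1) / 2) = q - 1 := by omega
  rw [← h2]
  refine mul_dvd_mul_left 2 (orderOf_dvd_of_pow_eq_one ?_)
  obtain ⟨s, _, rfl⟩ := Finset.mem_image.1 hy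
  rw [← pow_mul, Fin.val_zero, add_zero, mul_right_comm, h2, pow_mul, ← hg.2, pow_orderOf_eq_one,
    one_pow]

end Classes

/-! ### Augmented codes -/

theorem IsQuantumSynchronizableCode.mono {r : ℕ} [NeZero r] {cl cr N k tX tZ tX' tZ' : ℕ}
    {Q : Submodule ℂ (Qudits r N)} (h : IsQuantumSynchronizableCode r cl cr N k tX tZ Q)
    (hX : tX' ≤ tX) (hZ : tZ' ≤ tZ) : IsQuantumSynchronizableCode r cl cr N k tX' tZ' Q := by
  obtain ⟨hdim, M, V, hV⟩ := h
  exact ⟨hdim, M, V, fun j a b χ ha hb => hV j a b χ (ha.trans hX) (hb.trans hZ)⟩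

theorem exists_isPrimitiveRoot_galoisField {r n : ℕ} [Fact r.Prime]
    (hr : IsUnit (r : ZMod n)) :
    ∃ η : GaloisField r (orderOf (r : ZMod n)), IsPrimitiveRoot η n := by
  set ℓ := orderOf (r : ZMod n) with hℓ
  have hℓ0 : ℓ ≠ 0 := (orderOf_pos_of_isUnit hr).ne'
  have : Fintype (GaloisField r ℓ) := Fintype.ofFinite _
  have hcard : Nat.card (GaloisField r ℓ)ˣ = r ^ ℓ - 1 := by
    rw [Nat.card_units, GaloisField.card r ℓ hℓ0]
  have hdvd : n ∣ r ^ ℓ - 1 := by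
    have h1 : 1 ≤ r ^ ℓ := Nat.one_le_pow _ _ (Fact.out : r.Prime).pos
    rw [← ZMod.natCast_eq_zero_iff, Nat.cast_sub h1, Nat.cast_pow, hℓ, pow_orderOf_eq_one,
      Nat.cast_one, sub_self]
  obtain ⟨x, hx⟩ := IsCyclic.exists_ofOrder_eq_natCard (α := (GaloisField r ℓ)ˣ)
  obtain ⟨k, hk⟩ := hdvd
  have hpos : 0 < orderOf x := orderOf_pos x
  rw [hcard, hk] at hx
  have hk0 : k ≠ 0 := by
    rintro rfl
    rw [hx, mul_zero] at hpos
    exact hpos.false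
  have hxk : IsPrimitiveRoot (x ^ k) n := by
    have h := IsPrimitiveRoot.orderOf (x ^ k)
    rwa [orderOf_pow_of_dvd hk0 (hx ▸ dvd_mul_left k n), hx, Nat.mul_div_cancel _
      (Nat.pos_of_ne_zero hk0)] at h
  exact ⟨((x ^ k : (GaloisField r ℓ)ˣ) : GaloisField r ℓ), IsPrimitiveRoot.coe_units_iff.2 hxk⟩

/-- If the exponents in `S` include a unit modulo `n`, the product of their minimal polynomials has
order `n`. -/
theorem isPolyOrder_prod_minimalPoly {r n : ℕ} [Fact r.Prime] [NeZero n] {K : Type*} [Field K]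
    [Algebra (ZMod r) K] {η : K} (hη : IsPrimitiveRoot η n) {S : Finset (ZMod n)}
    (hdvd : ∏ t ∈ S, minimalPoly r η t ∣ X ^ n - 1) {t : ZMod n} (ht : t ∈ S) (hunit : IsUnit t) :
    IsPolyOrder (∏ t ∈ S, minimalPoly r η t) n := by
  refine ⟨⟨Nat.pos_of_ne_zero (NeZero.ne n), hdvd⟩, ?_⟩
  rintro d ⟨hd, hfd⟩
  have hx : IsPrimitiveRoot (η ^ t.val) n :=
    hη.pow_of_coprime _ ((ZMod.isUnit_iff_coprime _ _).1 (by rwa [ZMod.natCast_zmod_val]))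
  obtain ⟨p, hp⟩ := (Finset.dvd_prod_of_mem (minimalPoly r η) ht).trans hfd
  have h := congrArg (aeval (η ^ t.val)) hp
  rw [map_mul, minimalPoly, minpoly.aeval, zero_mul, map_sub, map_pow, aeval_X, map_one,
    sub_eq_zero] at h
  exact Nat.le_of_dvd hd (hx.dvd_of_pow_eq_one d h)

theorem card_representatives_eq {q g r : ℕ} (hq : q % 2 = 1) (hq1 : 1 < q)
    (hg : IsCommonPrimitiveRoot q g) (hr : (r : ZMod (2 * q)) ∈ classD q g 0) {i j : Fin 2}
    {T : Finset (ZMod (2 * q))}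
    (hT : IsCosetRepresentatives r (2 * q) (classD q g i ∪ classE q g j) T) :
    T.card = 2 * ((q - 1) / (2 * orderOf (r : ZMod (2 * q)))) := by
  have : NeZero (2 * q) := ⟨by omega⟩
  have hru := isUnit_of_mem_classD hq1 hg hr
  have hA := mul_mem_classD_union_classE (i := i) (j := j) hq hq1 hg hr
  have h := hT.card_biUnion hru hA (fun t ht => card_cosetFinset hq hq1 hg hru ht) subset_rfl
  rw [hT.biUnion_eq hru hA, card_classD_union_classE hq hq1 hg] at h
  obtain ⟨k, hk⟩ := two_mul_orderOf_dvd hq hg hr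
  have hpos := orderOf_pos_of_isUnit hru
  rw [hk, Nat.mul_div_cancel_left _ (by omega)]
  refine Nat.eq_of_mul_eq_mul_right hpos ?_
  rw [← h, hk]
  ring

theorem exists_ssubset_pair {q g r : ℕ} (hq : q % 2 = 1) (hq1 : 1 < q)
    (hg : IsCommonPrimitiveRoot q g) (hr : (r : ZMod (2 * q)) ∈ classD q g 0) {i j : Fin 2}
    {T : Finset (ZMod (2 * q))}
    (hT : IsCosetRepresentatives r (2 * q) (classD q g i ∪ classE q g j) T) {z : ℕ}
    (hz : z + 2 ≤ 2 * ((q - 1) / (2 * orderOf (r : ZMod (2 * q))))) :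
    ∃ S S' : Finset (ZMod (2 * q)), S ⊂ S' ∧ S' ⊂ T ∧ S.card = z ∧
      ∀ t ∈ S' \ S, t ∈ classD q g 0 ∪ classD q g 1 := by
  have : NeZero (2 * q) := ⟨by omega⟩
  have hru := isUnit_of_mem_classD hq1 hg hr
  rw [← card_representatives_eq hq hq1 hg hr hT] at hz
  -- a representative in `D_i`
  obtain ⟨t, htT, htD⟩ : ∃ t ∈ T, t ∈ classD q g i := by
    have ha : (g : ZMod (2 * q)) ^ (2 * 0 + (i : ℕ)) ∈ classD q g i :=
      (mem_classD_iff hq hq1 hg i).2 ⟨0, rfl⟩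
    obtain ⟨t, ⟨ht, s, hs⟩, _⟩ := hT.2 _ (Finset.mem_union_left (classE q g j) ha)
    refine ⟨t, ht, (Finset.mem_union.1 (hT.1 ht)).resolve_right fun hE => ?_⟩
    refine not_isUnit_of_mem_classE hE (isUnit_of_mul_isUnit_left ?_ (y := (r : ZMod (2 * q)) ^ s))
    exact hs ▸ isUnit_of_mem_classD hq1 hg ha
  obtain ⟨S, hS, hSz⟩ := Finset.exists_subset_card_eq (s := T.erase t) (n := z) (by
    rw [Finset.card_erase_of_mem htT]
    omega)
  have htS : t ∉ S := fun h => Finset.notMem_erase t T (hS h)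
  have hsub : insert t S ⊆ T :=
    Finset.insert_subset htT (hS.trans (Finset.erase_subset t T))
  refine ⟨S, insert t S, Finset.ssubset_insert htS, hsub.ssubset_of_ne fun h => ?_, hSz, ?_⟩
  · rw [← h, Finset.card_insert_of_notMem htS] at hz
    omega
  · intro x hx
    obtain ⟨hx, hxS⟩ := Finset.mem_sdiff.1 hx
    obtain rfl := (Finset.mem_insert.1 hx).resolve_right hxS
    fin_cases i
    · exact Finset.mem_union_left _ htD
    · exact Finset.mem_union_right _ htD

/-- The pair of augmented codes belonging to `S ⊂ S'`, and the synchronizable code it gives. -/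
theorem exists_augmented_codes {q g r : ℕ} [Fact r.Prime] (hq4 : q % 4 = 3)
    (hg : IsCommonPrimitiveRoot q g) (hr : (r : ZMod (2 * q)) ∈ classD q g 0) {K : Type*} [Field K]
    [Algebra (ZMod r) K] {η : K} (hη : IsPrimitiveRoot η (2 * q)) {i j : Fin 2} {G : (ZMod r)[X]}
    (hG : G.map (algebraMap (ZMod r) K) = rootsPoly η (classD q g i ∪ classE q g j))
    {T : Finset (ZMod (2 * q))}
    (hT : IsCosetRepresentatives r (2 * q) (classD q g i ∪ classE q g j) T)
    {S S' : Finset (ZMod (2 * q))} (hSS' : S ⊂ S') (hS'T : S' ⊂ T)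
    (hSD : ∀ t ∈ S' \ S, t ∈ classD q g 0 ∪ classD q g 1) :
    ∃ G₁ G₂ f : (ZMod r)[X],
      G = G₂ * ∏ t ∈ S, minimalPoly r η t ∧
      G = G₁ * ∏ t ∈ S', minimalPoly r η t ∧
      G₂ = G₁ * f ∧
      IsPolyOrder f (2 * q) ∧
      dualCode (cyclicCode (2 * q) G₂) ≤ cyclicCode (2 * q) G₂ ∧
      cyclicCode (2 * q) G ≤ cyclicCode (2 * q) G₂ ∧
      cyclicCode (2 * q) G₂ < cyclicCode (2 * q) G₁ ∧
      Module.finrank (ZMod r) (cyclicCode (2 * q) G₂) =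
        q + S.card * orderOf (r : ZMod (2 * q)) + 1 ∧
      Module.finrank (ZMod r) (cyclicCode (2 * q) G₁) =
        q + S'.card * orderOf (r : ZMod (2 * q)) + 1 ∧
      ∀ cl cr : ℕ, cl + cr < 2 * q →
        ∃ Q : Submodule ℂ (Qudits r (2 * q + cl + cr)),
          IsQuantumSynchronizableCode r cl cr (2 * q + cl + cr)
            (2 * S.card * orderOf (r : ZMod (2 * q)) + 2)
            ((minDistance (cyclicCode (2 * q) G₁) - 1) / 2)
            ((minDistance (cyclicCode (2 * q) G₂) - 1) / 2) Q := by
  have hq : q % 2 = 1 := by omega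
  have hq1 : 1 < q := by omega
  have : NeZero (2 * q) := ⟨by omega⟩
  have hru := isUnit_of_mem_classD hq1 hg hr
  have hA := mul_mem_classD_union_classE (i := i) (j := j) hq hq1 hg hr
  have hAcard := card_classD_union_classE hq hq1 hg i j
  have hneg := neg_notMem_classD_union_classE hq4 hg i j
  have hcoset := fun t ht => card_cosetFinset (i := i) (j := j) (t := t) hq hq1 hg hru ht
  set A := classD q g i ∪ classE q g j
  set ℓ := orderOf (r : ZMod (2 * q))
  have hS'T := hS'T.subset
  have hST := hSS'.subset.trans hS'T
  obtain ⟨G₂, hG₂, hGG₂⟩ := hT.exists_generator hη hru hA hG hST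
  obtain ⟨G₁, hG₁, hGG₁⟩ := hT.exists_generator hη hru hA hG hS'T
  have hfin : ∀ {R : Finset (ZMod (2 * q))} {P : (ZMod r)[X]}, R ⊆ T →
      P.map (algebraMap (ZMod r) K) = rootsPoly η (A \ R.biUnion (cosetFinset r)) →
      Module.finrank (ZMod r) (cyclicCode (2 * q) P) = q + R.card * ℓ + 1 := by
    intro R P hR hP
    have h := finrank_cyclicCode_of_map_eq_rootsPoly hη hP
    have h1 := Finset.card_le_card (hT.biUnion_subset hru hA hR)
    rw [Finset.card_sdiff_of_subset (hT.biUnion_subset hru hA hR)] at h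
    rw [hT.card_biUnion hru hA hcoset hR, hAcard] at h h1
    omega
  have hle : ∀ {A₁ A₂ : Finset (ZMod (2 * q))} {P₁ P₂ : (ZMod r)[X]},
      P₁.map (algebraMap (ZMod r) K) = rootsPoly η A₁ →
      P₂.map (algebraMap (ZMod r) K) = rootsPoly η A₂ → A₁ ⊆ A₂ →
      cyclicCode (2 * q) P₂ ≤ cyclicCode (2 * q) P₁ := by
    intro A₁ A₂ P₁ P₂ h₁ h₂ hsub c hc
    rw [mem_cyclicCode_iff_aeval hη h₁]
    exact fun t ht => (mem_cyclicCode_iff_aeval hη h₂ c).1 hc t (hsub ht)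
  have hG₂f : G₂ = G₁ * ∏ t ∈ S' \ S, minimalPoly r η t := by
    have hG0 : G ≠ 0 := by
      rintro rfl
      rw [Polynomial.map_zero] at hG
      exact (rootsPoly_monic A).ne_zero hG.symm
    have h0 : ∏ t ∈ S, minimalPoly r η t ≠ 0 := fun h => hG0 (by rw [hGG₂, h, mul_zero])
    refine mul_right_cancel₀ h0 ?_
    rw [← hGG₂, mul_assoc, Finset.prod_sdiff hSS'.subset, ← hGG₁]
  obtain ⟨t, htS', htS⟩ := Finset.exists_of_ssubset hSS'
  have ht : IsUnit t := by
    rcases Finset.mem_union.1 (hSD t (Finset.mem_sdiff.2 ⟨htS', htS⟩)) with h | h <;>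
      exact isUnit_of_mem_classD hq1 hg h
  have htself : t ∈ cosetFinset r t := (mem_cosetFinset hru).2 ⟨0, by simp⟩
  have ht₁ : t ∉ A \ S'.biUnion (cosetFinset r) := fun h =>
    (Finset.mem_sdiff.1 h).2 (Finset.mem_biUnion.2 ⟨t, htS', htself⟩)
  have ht₂ : t ∈ A \ S.biUnion (cosetFinset r) := by
    refine Finset.mem_sdiff.2 ⟨hT.1 (hS'T htS'), fun h => ?_⟩
    obtain ⟨t', ht', hmem⟩ := Finset.mem_biUnion.1 h
    refine Finset.disjoint_left.1 (hT.pairwiseDisjoint hru hA hS'T htS' (hSS'.subset ht') ?_)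
      htself hmem
    rintro rfl
    exact htS ht'
  have hdvd₂ := dvd_X_pow_sub_one_of_map_eq_rootsPoly hη hG₂
  have hdvd₁ := dvd_X_pow_sub_one_of_map_eq_rootsPoly hη hG₁
  have hdual := dualCode_cyclicCode_le hη hG₂ fun t ht h =>
    hneg t (Finset.mem_sdiff.1 ht).1 (Finset.mem_sdiff.1 h).1
  have h21 : cyclicCode (2 * q) G₂ ≤ cyclicCode (2 * q) G₁ :=
    hle hG₁ hG₂ (Finset.sdiff_subset_sdiff subset_rfl
      (Finset.biUnion_subset_biUnion_of_subset_left _ hSS'.subset))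
  have hfin₂ := hfin hST hG₂
  have hfin₁ := hfin hS'T hG₁
  refine ⟨G₁, G₂, ∏ t ∈ S' \ S, minimalPoly r η t, hGG₂, hGG₁, hG₂f,
    isPolyOrder_prod_minimalPoly hη ((Dvd.intro_left _ hG₂f.symm).trans hdvd₂)
      (Finset.mem_sdiff.2 ⟨htS', htS⟩) ht,
    hdual, hle hG₂ hG Finset.sdiff_subset, lt_of_le_of_ne h21 fun h => ?_, hfin₂, hfin₁, ?_⟩
  · rw [h, hfin₁] at hfin₂
    have : S.card * ℓ < S'.card * ℓ :=
      Nat.mul_lt_mul_of_pos_right (Finset.card_lt_card hSS') (orderOf_pos_of_isUnit hru)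
    omega
  · intro cl cr hclcr
    -- the coefficient word of `G₁` serves as the offset that marks the block boundary
    have hdeg : G₁.natDegree < 2 * q := by
      rw [natDegree_of_map_eq_rootsPoly hG₁]
      have := Finset.card_le_card (Finset.sdiff_subset (s := A) (t := S'.biUnion (cosetFinset r)))
      omega
    have hu : (fun k : Fin (2 * q) => G₁.coeff k) ∈ cyclicCode (2 * q) G₁ := by
      rw [mem_cyclicCode_iff hdvd₁, wordPoly_coeff hdeg]
    obtain ⟨Q, hQ⟩ := exists_isQuantumSynchronizableCode (n := 2 * q) (N := 2 * q + cl + cr)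
      (cl := cl) (cr := cr) (by omega) h21 hdual
      (fun y hy k => shift_mem_cyclicCode hη hG₁ hy k)
      (fun y hy k => shift_mem_cyclicCode hη hG₂ hy k) le_rfl le_rfl hu
      (fun k k' hk hk' h => eq_of_shift_sub_shift_mem hη hG₂ ht₂ ht
        (by
          rw [wordPoly_coeff hdeg]
          exact fun h => ht₁ ((aeval_eq_zero_iff_of_map_eq_rootsPoly hη hG₁ t).1 h))
        (by omega) (by omega) h)
    refine ⟨Q, ?_⟩
    have hk : 2 * S.card * ℓ + 2 =
        2 * Module.finrank (ZMod r) (cyclicCode (2 * q) G₂) - 2 * q := by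
      rw [hfin₂, mul_assoc]
      omega
    rw [hk]
    exact hQ

theorem theorem5 (q m r g : ℕ) [Fact r.Prime] (hq : q.Prime) (hqm : q = 4 * m + 3)
    (hg : IsCommonPrimitiveRoot q g) (hr : (r : ZMod (2 * q)) ∈ classD q g 0)
    (ℓ : ℕ) (hℓ : ℓ = orderOf (r : ZMod (2 * q))) (θ : ℕ) (hθ : θ = (q - 1) / (2 * ℓ)) :
    -- the quotient defining `θ` is exact
    2 * ℓ ∣ q - 1 ∧
    -- existence of the codes
    (∀ z cl cr : ℕ, z + 2 ≤ 2 * θ → cl + cr < 2 * q →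
      ∃ Q : Submodule ℂ (Qudits r (2 * q + cl + cr)),
        IsQuantumSynchronizableCode r cl cr (2 * q + cl + cr) (2 * z * ℓ + 2) 0 0 Q) ∧
    -- the cyclic codes they come from
    (∃ η : GaloisField r ℓ, IsPrimitiveRoot η (2 * q)) ∧
    ∀ η : GaloisField r ℓ, IsPrimitiveRoot η (2 * q) → ∀ i j : Fin 2,
      ∃ G : (ZMod r)[X],
        G.map (algebraMap (ZMod r) (GaloisField r ℓ)) =
          rootsPoly η (classD q g i) * rootsPoly η (classE q g j) ∧
        dualCode (cyclicCode (2 * q) G) ≤ cyclicCode (2 * q) G ∧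
        ∀ T : Finset (ZMod (2 * q)),
          IsCosetRepresentatives r (2 * q) (classD q g i ∪ classE q g j) T →
          -- suitable pairs of augmented codes exist for every admissible `z`
          (∀ z : ℕ, z + 2 ≤ 2 * θ → ∃ S S' : Finset (ZMod (2 * q)),
            S ⊂ S' ∧ S' ⊂ T ∧ S.card = z ∧
              ∀ t ∈ S' \ S, t ∈ classD q g 0 ∪ classD q g 1) ∧
          -- every such pair gives codes with maximal synchronization capability
          ∀ S S' : Finset (ZMod (2 * q)), S ⊂ S' → S' ⊂ T →
            (∀ t ∈ S' \ S, t ∈ classD q g 0 ∪ classD q g 1) →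
            ∃ G₁ G₂ f : (ZMod r)[X],
              G = G₂ * ∏ t ∈ S, minimalPoly r η t ∧
              G = G₁ * ∏ t ∈ S', minimalPoly r η t ∧
              G₂ = G₁ * f ∧
              IsPolyOrder f (2 * q) ∧
              dualCode (cyclicCode (2 * q) G₂) ≤ cyclicCode (2 * q) G₂ ∧
              cyclicCode (2 * q) G ≤ cyclicCode (2 * q) G₂ ∧
              cyclicCode (2 * q) G₂ < cyclicCode (2 * q) G₁ ∧
              Module.finrank (ZMod r) (cyclicCode (2 * q) G₂) = q + S.card * ℓ + 1 ∧
              Module.finrank (ZMod r) (cyclicCode (2 * q) G₁) = q + S'.card * ℓ + 1 ∧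
              ∀ cl cr : ℕ, cl + cr < 2 * q →
                ∃ Q : Submodule ℂ (Qudits r (2 * q + cl + cr)),
                  IsQuantumSynchronizableCode r cl cr (2 * q + cl + cr) (2 * S.card * ℓ + 2)
                    ((minDistance (cyclicCode (2 * q) G₁) - 1) / 2)
                    ((minDistance (cyclicCode (2 * q) G₂) - 1) / 2) Q := by
  subst hℓ hθ
  have hq4 : q % 4 = 3 := by omega
  have hq2 : q % 2 = 1 := by omega
  have hq1 : 1 < q := hq.one_lt
  have : NeZero (2 * q) := ⟨by omega⟩
  have hru := isUnit_of_mem_classD hq1 hg hr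
  have hA := fun i j => mul_mem_classD_union_classE (i := i) (j := j) hq2 hq1 hg hr
  have hunion : ∀ (η : GaloisField r (orderOf (r : ZMod (2 * q)))) (i j : Fin 2),
      rootsPoly η (classD q g i) * rootsPoly η (classE q g j) =
        rootsPoly η (classD q g i ∪ classE q g j) := by
    intro η i j
    refine (Finset.prod_union (Finset.disjoint_left.2 fun x hx hx' => ?_)).symm
    exact not_isUnit_of_mem_classE hx' (isUnit_of_mem_classD hq1 hg hx)
  have hroot := exists_isPrimitiveRoot_galoisField hru
  refine ⟨two_mul_orderOf_dvd hq2 hg hr, ?_, hroot, ?_⟩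
  · intro z cl cr hz hclcr
    obtain ⟨η, hη⟩ := hroot
    obtain ⟨G, hG⟩ := exists_map_eq_rootsPoly hη hru (hA 0 0)
    obtain ⟨T, hT⟩ := exists_isCosetRepresentatives hru (hA 0 0)
    obtain ⟨S, S', hSS', hS'T, rfl, hSD⟩ := exists_ssubset_pair hq2 hq1 hg hr hT hz
    obtain ⟨G₁, G₂, _, _, _, _, _, _, _, _, _, _, h⟩ :=
      exists_augmented_codes hq4 hg hr hη hG hT hSS' hS'T hSD
    obtain ⟨Q, hQ⟩ := h cl cr hclcr
    exact ⟨Q, hQ.mono (Nat.zero_le _) (Nat.zero_le _)⟩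
  · intro η hη i j
    obtain ⟨G, hG⟩ := exists_map_eq_rootsPoly hη hru (hA i j)
    refine ⟨G, by rw [hG, hunion],
      dualCode_cyclicCode_le hη hG (neg_notMem_classD_union_classE hq4 hg i j), fun T hT => ?_⟩
    exact ⟨fun z hz => exists_ssubset_pair hq2 hq1 hg hr hT hz,
      fun S S' hSS' hS'T hSD => exists_augmented_codes hq4 hg hr hη hG hT hSS' hS'T hSD⟩
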